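/- Throughout, for a compact metric space $X$, $\mathrm{Prob}(X)$ is the space of Borel probability measures on $X$ with the weak$^*$-topology, and for a unital $C^*$-algebra $A$, $T(A)$ is the space of tracial states on $A$ with the weak$^*$-topology. A metric $\omega$ on a convex set is \emph{effectively quasiconvex} with respect to an increasing function $h\colon[0,\infty)\to[0,\infty)$ with $\lim_{x\to0}h(x)=0$ if $\omega(\sum_i\lambda_i\sigma_i,\sum_i\lambda_i\tau_i)\le h(\max_i\omega(\sigma_i,\tau_i))$ for all finite convex combinations. A \emph{tracially lyriform $C^*$-algebra} $(A,\omega)$ is a separable, unital $C^*$-algebra $A$ with a metric $\omega$ on $T(A)$ that has finite diameter, is weak$^*$-lower semicontinuous on $T(A)\times T(A)$, is effectively quasiconvex with respect to some $h$, and is such that the set of $a\in A$ with $\sup_{\sigma\ne\tau}|\sigma(a)-\tau(a)|/\omega(\sigma,\tau)<\infty$ is norm-dense in $A$. A \emph{quasi-Wasserstein metric} $\Omega$ is, for some $D\in[0,\infty]$, a family of metrics $\Omega_X=\Omega_{(X,\rho)}$ on $\mathrm{Prob}(X)$, one for each nonempty compact metric space $(X,\rho)$ of diameter at most $D$, such that: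 (1) $\Omega_X$ induces the weak$^*$-topology and $\Omega_X(\delta_x,\delta_y)=\rho(x,y)$; (2) if $f\colon X_1\to X_2$ is $K$-Lipschitz with $K\ge1$, then so is the pushforward $f_*\colon(\mathrm{Prob}(X_1),\Omega_{X_1})\to(\mathrm{Prob}(X_2),\Omega_{X_2})$, and $f_*$ is isometric if $f$ is; (3) for every $M>0$ there is one function $h$ as above with respect to which $\Omega_X$ is effectively quasiconvex whenever $\mathrm{diam}(X)\le M$; (4) there is a constant $K>0$ with $W_{1,\rho}\le K\,\Omega_X$ for every $X$, where $W_{1,\rho}$ is the $1$-Wasserstein metric. An \emph{$\Omega$-quasi-Wasserstein space} observing a nonempty compact metric space $X$ of diameter at most $D$ is a tracially lyriform $C^*$-algebra $(A,\omega)$ such that $T(A)$ is affinely homeomorphic to $\mathrm{Prob}(X)$ in such a way that $\omega$ corresponds to $\Omega_X$. A \emph{tracial isomorphism} between $(A_1,\omega_1)$ and $(A_2,\omega_2)$ is an affine isometric bijection $(T(A_2),\omega_2)\to(T(A_1),\omega_1)$. For $\varepsilon>0$, let $\Gamma_\varepsilon(T(A_i),T(A_j))$ be the set of continuous affine maps $f\colon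 T(A_i)\to T(A_j)$ such that $|\omega_j(f(\sigma),f(\tau))-\omega_i(\sigma,\tau)|<\varepsilon$ for all $\sigma,\tau\in T(A_i)$ and for which there is a continuous affine map $g\colon T(A_j)\to T(A_i)$ with $\omega_j(f(g(\tau)),\tau)<\varepsilon$ for all $\tau\in T(A_j)$. The \emph{quantum intertwining gap} $\gamma_q((A_1,\omega_1),(A_2,\omega_2))$ is the infimum of all $\varepsilon>0$ for which $\Gamma_\varepsilon(T(A_1),T(A_2))$ and $\Gamma_\varepsilon(T(A_2),T(A_1))$ are both nonempty. \textbf{Theorem.} Let $\Omega$ be a quasi-Wasserstein metric. On $\Omega$-quasi-Wasserstein spaces observing nonempty compact metric spaces, $\gamma_q$ is finite and depends only on tracial isomorphism classes, and on the set of these classes it is a separable, complete $2$-quasimetric. That is: $\gamma_q\ge0$; $\gamma_q$ is symmetric; $\gamma_q$ vanishes exactly on pairs of equal classes; $\gamma_q(x,z)\le2(\gamma_q(x,y)+\gamma_q(y,z))$; there is a countable $\gamma_q$-dense set of classes; and every $\gamma_q$-Cauchy sequence of classes $\gamma_q$-converges to a class. -/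

import Mathlib

open Filter Topology MeasureTheory
open scoped ENNReal NNReal ComplexOrder

universe u

/-! ### Metrics, moduli and convex combinations -/

/-- `d` is a metric on `K` (as a real-valued distance function). -/
structure IsMetricOn {K : Type*} (d : K → K → ℝ) : Prop where
  eq_zero_iff : ∀ x y, d x y = 0 ↔ x = y
  symm : ∀ x y, d x y = d y x
  triangle : ∀ x y z, d x z ≤ d x y + d y z

/-- `d` is a `c`-quasimetric on `Q`: the axioms of a metric hold, except that the triangle
inequality is weakened to `d x z ≤ c (d x y + d y z)`. -/
structure IsQuasimetric {Q : Type*} (c : ℝ) (d : Q → Q → ℝ) : Prop where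
  nonneg : ∀ x y, 0 ≤ d x y
  eq_zero_iff : ∀ x y, d x y = 0 ↔ x = y
  symm : ∀ x y, d x y = d y x
  triangle : ∀ x y z, d x z ≤ c * (d x y + d y z)

/-- There is a countable `d`-dense subset. -/
def IsSeparableQuasimetric {Q : Type*} (d : Q → Q → ℝ) : Prop :=
  ∃ S : Set Q, S.Countable ∧ ∀ x, ∀ ε > 0, ∃ s ∈ S, d x s < ε

/-- Every `d`-Cauchy sequence `d`-converges. -/
def IsCompleteQuasimetric {Q : Type*} (d : Q → Q → ℝ) : Prop :=
  ∀ x : ℕ → Q, (∀ ε > 0, ∃ N, ∀ m ≥ N, ∀ n ≥ N, d (x m) (x n) < ε) →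
    ∃ y, Tendsto (fun n => d (x n) y) atTop (𝓝 0)

/-- Sets on which one can say that a point is the convex combination of finitely many points with
given weights. Used only for trace spaces and for spaces of probability measures. -/
class HasConvexCombination (K : Type*) where
  /-- `IsCombination w σ s` says that `s = ∑ i, w i • σ i`. -/
  IsCombination : ∀ {n : ℕ}, (Fin n → ℝ) → (Fin n → K) → K → Prop

/-- A map is affine if it preserves finite convex combinations. -/
def IsAffineMap {K L : Type*} [HasConvexCombination K] [HasConvexCombination L]
    (f : K → L) : Prop :=
  ∀ (n : ℕ) (w : Fin n → ℝ), w ∈ stdSimplex ℝ (Fin n) → ∀ (σ : Fin n → K) (s : K),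
    HasConvexCombination.IsCombination w σ s →
      HasConvexCombination.IsCombination w (fun i => f (σ i)) (f s)

/-- An increasing function `h : [0, ∞) → [0, ∞)` with `h(x) → 0` as `x → 0`. -/
structure IsModulus (h : ℝ → ℝ) : Prop where
  mono : MonotoneOn h (Set.Ici 0)
  nonneg : ∀ x, 0 ≤ x → 0 ≤ h x
  tendsto_zero : Tendsto h (𝓝[>] 0) (𝓝 0)

/-- `d(∑ λᵢ σᵢ, ∑ λᵢ τᵢ) ≤ h(maxᵢ d(σᵢ, τᵢ))` for all finite convex combinations. -/
def IsQuasiconvexWith {K : Type*} [HasConvexCombination K] (d : K → K → ℝ) (h : ℝ → ℝ) : Prop :=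
  ∀ (n : ℕ) (w : Fin n → ℝ), w ∈ stdSimplex ℝ (Fin n) → ∀ (σ τ : Fin n → K) (s t : K),
    HasConvexCombination.IsCombination w σ s → HasConvexCombination.IsCombination w τ t →
      d s t ≤ h (⨆ i, d (σ i) (τ i))

/-! ### Trace spaces -/

/-- A tracial state: a positive linear functional with `τ(1) = 1` (so of norm one) and
`τ(u a u*) = τ(a)` for every unitary `u`. -/
structure IsTracialState {A : Type u} [CStarAlgebra A] (τ : WeakDual ℂ A) : Prop where
  pos : ∀ a : A, 0 ≤ τ (star a * a)
  map_one : τ 1 = 1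
  map_conj : ∀ a : A, ∀ v ∈ unitary A, τ (v * a * star v) = τ a

/-- The trace space `T(A)`, with the weak-* topology. -/
abbrev TraceSpace (A : Type u) [CStarAlgebra A] : Type u :=
  {τ : WeakDual ℂ A // IsTracialState τ}

instance (A : Type u) [CStarAlgebra A] : HasConvexCombination (TraceSpace A) where
  IsCombination w σ s := ∀ a : A, s.1 a = ∑ i, (w i : ℂ) * (σ i).1 a

/-- The seminorm `L_ρ(a) = sup {|σ(a) - τ(a)| / ρ(σ, τ) | σ ≠ τ}`, with values in `[0, ∞]`. -/
noncomputable def tracialLipschitzSeminorm {A : Type u} [CStarAlgebra A]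
    (ρ : TraceSpace A → TraceSpace A → ℝ) (a : A) : ℝ≥0∞ :=
  ⨆ (σ : TraceSpace A) (τ : TraceSpace A) (_ : σ ≠ τ),
    ENNReal.ofReal (‖σ.1 a - τ.1 a‖ / ρ σ τ)

/-- `(A, ρ)` is a tracially lyriform C*-algebra. -/
structure IsTraciallyLyriform (A : Type u) [CStarAlgebra A]
    (ρ : TraceSpace A → TraceSpace A → ℝ) : Prop where
  separable : TopologicalSpace.SeparableSpace A
  isMetric : IsMetricOn ρ
  finite_diam : ∃ C, ∀ σ τ, ρ σ τ ≤ C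
  lowerSemicontinuous : LowerSemicontinuous fun p : TraceSpace A × TraceSpace A => ρ p.1 p.2
  quasiconvex : ∃ h, IsModulus h ∧ IsQuasiconvexWith ρ h
  dense_lipschitz : Dense {a : A | tracialLipschitzSeminorm ρ a < ⊤}

/-! ### Quasi-Wasserstein metrics -/

instance (X : Type*) [MeasurableSpace X] : HasConvexCombination (ProbabilityMeasure X) where
  IsCombination w μ m := (m : Measure X) = ∑ i, ENNReal.ofReal (w i) • (μ i : Measure X)

/-- The Dirac probability measure at `x`. -/
noncomputable def diracProb {X : Type*} [MeasurableSpace X] (x : X) : ProbabilityMeasure X :=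
  ⟨Measure.dirac x, inferInstance⟩

/-- The `1`-Wasserstein distance: the infimum of `∫ ρ(x, y) dπ(x, y)` over all couplings `π`. -/
noncomputable def wassersteinOne {X : Type*} [MetricSpace X] [MeasurableSpace X]
    (μ ν : ProbabilityMeasure X) : ℝ :=
  sInf {c : ℝ | ∃ π : ProbabilityMeasure (X × X),
    (π : Measure (X × X)).map Prod.fst = μ ∧ (π : Measure (X × X)).map Prod.snd = ν ∧
      c = ∫ z, dist z.1 z.2 ∂(π : Measure (X × X))}

/-- A quasi-Wasserstein metric: a family of metrics on the spaces `Prob(X)`, one for each nonempty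
compact metric space `X` of diameter at most `D ∈ [0, ∞]`. (The values of `distance` on spaces of
larger diameter are irrelevant.) -/
structure QuasiWassersteinMetric where
  D : ℝ≥0∞
  distance : ∀ (X : Type u) [MetricSpace X] [CompactSpace X] [Nonempty X] [MeasurableSpace X]
    [BorelSpace X], ProbabilityMeasure X → ProbabilityMeasure X → ℝ
  isMetric : ∀ (X : Type u) [MetricSpace X] [CompactSpace X] [Nonempty X] [MeasurableSpace X]
    [BorelSpace X], Metric.ediam (Set.univ : Set X) ≤ D → IsMetricOn (distance X)
  /-- The metric induces the weak-* topology. -/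
  topology : ∀ (X : Type u) [MetricSpace X] [CompactSpace X] [Nonempty X] [MeasurableSpace X]
    [BorelSpace X], Metric.ediam (Set.univ : Set X) ≤ D → ∀ s : Set (ProbabilityMeasure X),
      IsOpen s ↔ ∀ μ ∈ s, ∃ ε > 0, ∀ ν, distance X μ ν < ε → ν ∈ s
  /-- The metric agrees with the given one on `X`. -/
  dirac : ∀ (X : Type u) [MetricSpace X] [CompactSpace X] [Nonempty X] [MeasurableSpace X]
    [BorelSpace X], Metric.ediam (Set.univ : Set X) ≤ D → ∀ x y : X,
      distance X (diracProb x) (diracProb y) = dist x y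
  /-- Pushforward along a `K`-Lipschitz map, `K ≥ 1`, is `K`-Lipschitz. -/
  pushforward_lipschitz : ∀ (X Y : Type u)
    [MetricSpace X] [CompactSpace X] [Nonempty X] [MeasurableSpace X] [BorelSpace X]
    [MetricSpace Y] [CompactSpace Y] [Nonempty Y] [MeasurableSpace Y] [BorelSpace Y],
    Metric.ediam (Set.univ : Set X) ≤ D → Metric.ediam (Set.univ : Set Y) ≤ D →
    ∀ (f : X → Y) (K : ℝ≥0), 1 ≤ K → ∀ hf : LipschitzWith K f, ∀ μ ν : ProbabilityMeasure X,
      distance Y (μ.map hf.continuous.measurable.aemeasurable)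
        (ν.map hf.continuous.measurable.aemeasurable) ≤ K * distance X μ ν
  /-- Pushforward along an isometric map is isometric. -/
  pushforward_isometry : ∀ (X Y : Type u)
    [MetricSpace X] [CompactSpace X] [Nonempty X] [MeasurableSpace X] [BorelSpace X]
    [MetricSpace Y] [CompactSpace Y] [Nonempty Y] [MeasurableSpace Y] [BorelSpace Y],
    Metric.ediam (Set.univ : Set X) ≤ D → Metric.ediam (Set.univ : Set Y) ≤ D →
    ∀ (f : X → Y) (hf : Isometry f) (μ ν : ProbabilityMeasure X),
      distance Y (μ.map hf.continuous.measurable.aemeasurable)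
        (ν.map hf.continuous.measurable.aemeasurable) = distance X μ ν
  /-- Uniform effective quasiconvexity on spaces of bounded diameter. -/
  quasiconvex : ∀ M : ℝ, 0 < M → ∃ h, IsModulus h ∧
    ∀ (X : Type u) [MetricSpace X] [CompactSpace X] [Nonempty X] [MeasurableSpace X]
      [BorelSpace X], Metric.ediam (Set.univ : Set X) ≤ D →
      Metric.ediam (Set.univ : Set X) ≤ ENNReal.ofReal M → IsQuasiconvexWith (distance X) h
  /-- Uniform lower bound by the `1`-Wasserstein metric. -/
  wasserstein_le : ∃ K : ℝ, 0 < K ∧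
    ∀ (X : Type u) [MetricSpace X] [CompactSpace X] [Nonempty X] [MeasurableSpace X]
      [BorelSpace X], Metric.ediam (Set.univ : Set X) ≤ D → ∀ μ ν : ProbabilityMeasure X,
      wassersteinOne μ ν ≤ K * distance X μ ν

/-- `(A, ω)` observes the compact metric space `X` through `Ω`: the trace space `T(A)` is
identified, as a compact convex set, with `Prob(X)` (equivalently, `T(A)` is a Bauer simplex whose
extreme boundary is identified with `X`), and `ω = Ω_X` under this identification. -/
def Observes (Ω : QuasiWassersteinMetric.{u}) (A : Type u) [CStarAlgebra A]
    (ω : TraceSpace A → TraceSpace A → ℝ) (X : Type u) [MetricSpace X] [CompactSpace X]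
    [Nonempty X] [MeasurableSpace X] [BorelSpace X] : Prop :=
  ∃ e : ProbabilityMeasure X ≃ₜ TraceSpace A,
    IsAffineMap e ∧ ∀ μ ν, ω (e μ) (e ν) = Ω.distance X μ ν

/-- A tracial `Ω`-quasi-Wasserstein space: a tracially lyriform C*-algebra `(A, ω)` with
`ω = Ω_X` for some nonempty compact metric space `X`, of diameter at most `D`, that it observes. -/
structure QuasiWassersteinSpace (Ω : QuasiWassersteinMetric.{u}) where
  A : Type u
  [cstarAlgebra : CStarAlgebra A]
  ω : TraceSpace A → TraceSpace A → ℝ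
  lyriform : IsTraciallyLyriform A ω
  observes : ∃ (X : Type u) (_ : MetricSpace X) (_ : CompactSpace X) (_ : Nonempty X)
    (_ : MeasurableSpace X) (_ : BorelSpace X),
      Metric.ediam (Set.univ : Set X) ≤ Ω.D ∧ Observes Ω A ω X

attribute [instance] QuasiWassersteinSpace.cstarAlgebra

/-! ### The quantum intertwining gap -/

/-- The set `Γ_ε((T(A), ω), (T(B), ω'))` of continuous affine maps that are `ε`-isometric and
`ε`-invertible. -/
def almostIsometries {A B : Type u} [CStarAlgebra A] [CStarAlgebra B]
    (ω : TraceSpace A → TraceSpace A → ℝ) (ω' : TraceSpace B → TraceSpace B → ℝ) (ε : ℝ) :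
    Set (TraceSpace A → TraceSpace B) :=
  {f | Continuous f ∧ IsAffineMap f ∧ (∀ σ τ, |ω' (f σ) (f τ) - ω σ τ| < ε) ∧
    ∃ g : TraceSpace B → TraceSpace A, Continuous g ∧ IsAffineMap g ∧ ∀ τ, ω' (f (g τ)) τ < ε}

/-- The set of admissible `ε` in the definition of the gap. -/
def gapSet {A B : Type u} [CStarAlgebra A] [CStarAlgebra B]
    (ω : TraceSpace A → TraceSpace A → ℝ) (ω' : TraceSpace B → TraceSpace B → ℝ) : Set ℝ :=
  {ε | 0 < ε ∧ (almostIsometries ω ω' ε).Nonempty ∧ (almostIsometries ω' ω ε).Nonempty}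

/-- The quantum intertwining gap `γ_q((A, ω), (B, ω'))`. -/
noncomputable def quantumIntertwiningGap {A B : Type u} [CStarAlgebra A] [CStarAlgebra B]
    (ω : TraceSpace A → TraceSpace A → ℝ) (ω' : TraceSpace B → TraceSpace B → ℝ) : ℝ :=
  sInf (gapSet ω ω')

/-- A tracial isomorphism: an affine isometric bijection `T(B) → T(A)`. -/
def TraciallyIsomorphic {A B : Type u} [CStarAlgebra A] [CStarAlgebra B]
    (ω : TraceSpace A → TraceSpace A → ℝ) (ω' : TraceSpace B → TraceSpace B → ℝ) : Prop :=
  ∃ f : TraceSpace B ≃ TraceSpace A, IsAffineMap f ∧ ∀ σ τ, ω (f σ) (f τ) = ω' σ τ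

theorem exists_trace_combination {A : Type u} [CStarAlgebra A] {n : ℕ} (w : Fin n → ℝ)
    (hw : w ∈ stdSimplex ℝ (Fin n)) (σ : Fin n → TraceSpace A) :
    ∃ s : TraceSpace A, HasConvexCombination.IsCombination w σ s := by
  have key : ∀ a : A, (∑ i, (w i : ℂ) • (σ i).1 : WeakDual ℂ A) a
      = ∑ i, (w i : ℂ) * (σ i).1 a := by
    intro a
    have h : ∀ t : Finset (Fin n), (∑ i ∈ t, (w i : ℂ) • (σ i).1 : WeakDual ℂ A) a
        = ∑ i ∈ t, (w i : ℂ) * (σ i).1 a := by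
      intro t
      induction t using Finset.induction_on with
      | empty => simp; rfl
      | insert i t hi ih => rw [Finset.sum_insert hi, Finset.sum_insert hi, ← ih]; rfl
    exact h _
  refine ⟨⟨∑ i, (w i : ℂ) • (σ i).1, ⟨fun a => ?_, ?_, fun a v hv => ?_⟩⟩, fun a => key a⟩
  · rw [key]
    exact Finset.sum_nonneg fun i _ =>
      mul_nonneg (by exact_mod_cast hw.1 i) ((σ i).2.pos a)
  · rw [key]
    simp only [(σ _).2.map_one, mul_one]
    exact_mod_cast hw.2
  · rw [key, key]
    simp only [(σ _).2.map_conj a v hv]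

theorem trace_affine_symm {A B : Type u} [CStarAlgebra A] [CStarAlgebra B]
    (f : TraceSpace B ≃ TraceSpace A) (hf : IsAffineMap f) : IsAffineMap f.symm := by
  intro n w hw σ s hs
  obtain ⟨t, ht⟩ := exists_trace_combination w hw (fun i => f.symm (σ i))
  have h1 := hf n w hw _ t ht
  have h2 : f t = s := by
    refine Subtype.ext (DFunLike.ext _ _ fun a => ?_)
    rw [h1 a, hs a]
    simp
  rw [← h2, f.symm_apply_apply]
  exact ht

/-- Tracial isomorphism as an equivalence relation on `Ω`-quasi-Wasserstein spaces. -/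
def tracialSetoid (Ω : QuasiWassersteinMetric.{u}) : Setoid (QuasiWassersteinSpace Ω) where
  r S T := TraciallyIsomorphic S.ω T.ω
  iseqv := by
    refine ⟨fun S => ⟨Equiv.refl _, fun _ _ _ _ _ h => h, fun _ _ => rfl⟩, ?_, ?_⟩
    · rintro S T ⟨f, hf, hd⟩
      exact ⟨f.symm, trace_affine_symm f hf, fun σ τ => by simp [← hd]⟩
    · rintro S T U ⟨f, hf, hd⟩ ⟨g, hg, hd'⟩
      exact ⟨g.trans f, fun n w hw σ s h => hf n w hw _ _ (hg n w hw σ s h),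
        fun σ τ => by simp [hd, hd']⟩

/-- Tracial isomorphism classes of `Ω`-quasi-Wasserstein spaces. -/
abbrev TracialClass (Ω : QuasiWassersteinMetric.{u}) : Type (u + 1) :=
  Quotient (tracialSetoid Ω)

/-- The tracial isomorphism class of an `Ω`-quasi-Wasserstein space. -/
abbrev tracialClass {Ω : QuasiWassersteinMetric.{u}} (S : QuasiWassersteinSpace Ω) :
    TracialClass Ω :=
  Quotient.mk (tracialSetoid Ω) S

/-! The trace space of an $\Omega$-quasi-Wasserstein space is a copy of $\mathrm{Prob}(X)$, so it is
compact and its metric induces its topology. The axioms of a quasimetric only use this. Constant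
maps make the gap finite; almost isometries compose with errors that add up to at most twice the
sum; and if the gap vanishes, pointwise ultralimits of $\varepsilon$-isometric,
$\varepsilon$-invertible affine maps form a tracial isomorphism
(`traciallyIsomorphic_of_forall_almostIsometries`).

Separability and completeness are transferred from the Gromov-Hausdorff space. The main estimate,
`QuasiWassersteinMetric.exists_almostIsometricProb`, says that for fixed $X$ a space $Y$
sufficiently Gromov-Hausdorff close to $X$ has $\mathrm{Prob}(Y)$ almost isometric to
$\mathrm{Prob}(X)$. Take a finite net $x_i$ in $X$ and corresponding points $y_i$ in $Y$. With a
subordinate partition of unity $\varphi_i$, the affine map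
$\mu\mapsto\sum_i\mu(\varphi_i)\delta_{y_i}$ is the desired one: replacing $y_i$ by $x_i$ gives a
map close to the identity by quasiconvexity, and passing from $x_i$ to $y_i$ is nearly isometric by
the Lipschitz axiom on finite spaces, the correspondence being bi-Lipschitz on the net with constant
near 1.

Hence a countable set of classes whose observed spaces are dense among all observed spaces is dense
for the gap. For completeness, almost isometries restricted to Dirac measures bound the diameters
and covering numbers of the spaces observed along a Cauchy sequence. Gromov's precompactness theorem
yields a subsequential limit $X$, which is observed by $C(X)$ (`isTraciallyLyriform_continuousMap`).
The main estimate then gives gap convergence along the subsequence, and the weak triangle inequality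
extends it to the whole sequence. -/

/-! ### Convex combinations of probability measures -/

section Mixture

variable {X : Type*} [MeasurableSpace X] {n : ℕ} {w : Fin n → ℝ}

theorem isProbabilityMeasure_mixture (hw : w ∈ stdSimplex ℝ (Fin n))
    (μ : Fin n → ProbabilityMeasure X) :
    IsProbabilityMeasure (∑ i, ENNReal.ofReal (w i) • (μ i : Measure X)) := by
  constructor
  simp only [Measure.coe_finsetSum, Finset.sum_apply, Measure.smul_apply, measure_univ,
    smul_eq_mul, mul_one]
  rw [← ENNReal.ofReal_sum_of_nonneg fun i _ => hw.1 i, hw.2, ENNReal.ofReal_one]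

/-- The convex combination `∑ i, w i • μ i` of probability measures. -/
noncomputable def mixture (hw : w ∈ stdSimplex ℝ (Fin n)) (μ : Fin n → ProbabilityMeasure X) :
    ProbabilityMeasure X :=
  ⟨∑ i, ENNReal.ofReal (w i) • (μ i : Measure X), isProbabilityMeasure_mixture hw μ⟩

/-- The finitely supported probability measure `∑ i, w i • δ (x i)`. -/
noncomputable def atomic (hw : w ∈ stdSimplex ℝ (Fin n)) (x : Fin n → X) :
    ProbabilityMeasure X :=
  mixture hw fun i => diracProb (x i)

theorem isCombination_mixture (hw : w ∈ stdSimplex ℝ (Fin n))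
    (μ : Fin n → ProbabilityMeasure X) :
    HasConvexCombination.IsCombination w μ (mixture hw μ) := rfl

theorem eq_mixture_of_isCombination (hw : w ∈ stdSimplex ℝ (Fin n))
    {μ : Fin n → ProbabilityMeasure X} {m : ProbabilityMeasure X}
    (h : HasConvexCombination.IsCombination w μ m) : m = mixture hw μ :=
  Subtype.ext h

theorem isCombination_const (hw : w ∈ stdSimplex ℝ (Fin n)) (μ : ProbabilityMeasure X) :
    HasConvexCombination.IsCombination w (fun _ => μ) μ := by
  change (μ : Measure X) = ∑ i, ENNReal.ofReal (w i) • (μ : Measure X)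
  rw [← Finset.sum_smul, ← ENNReal.ofReal_sum_of_nonneg fun i _ => hw.1 i, hw.2,
    ENNReal.ofReal_one, one_smul]

theorem IsAffineMap.map_mixture {L : Type*} [HasConvexCombination L]
    {f : ProbabilityMeasure X → L} (hf : IsAffineMap f) (hw : w ∈ stdSimplex ℝ (Fin n))
    (μ : Fin n → ProbabilityMeasure X) :
    HasConvexCombination.IsCombination w (fun i => f (μ i)) (f (mixture hw μ)) :=
  hf n w hw _ _ rfl

theorem integral_mixture {E : Type*} [NormedAddCommGroup E] [NormedSpace ℝ E]
    (hw : w ∈ stdSimplex ℝ (Fin n)) (μ : Fin n → ProbabilityMeasure X) {f : X → E}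
    (hf : ∀ i, Integrable f (μ i : Measure X)) :
    ∫ z, f z ∂(mixture hw μ : Measure X) = ∑ i, w i • ∫ z, f z ∂(μ i : Measure X) := by
  change ∫ z, f z ∂(∑ i, ENNReal.ofReal (w i) • (μ i : Measure X)) = _
  rw [integral_finsetSum_measure fun i _ => (hf i).smul_measure ENNReal.ofReal_ne_top]
  refine Finset.sum_congr rfl fun i _ => ?_
  rw [integral_smul_measure, ENNReal.toReal_ofReal (hw.1 i)]

theorem IsAffineMap.id {K : Type*} [HasConvexCombination K] : IsAffineMap (fun x : K => x) :=
  fun _ _ _ _ _ h => h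

theorem IsAffineMap.comp {K L M : Type*} [HasConvexCombination K] [HasConvexCombination L]
    [HasConvexCombination M] {g : L → M} {f : K → L} (hg : IsAffineMap g) (hf : IsAffineMap f) :
    IsAffineMap fun x => g (f x) :=
  fun n w hw _ _ h => hg n w hw _ _ (hf n w hw _ _ h)

theorem isAffineMap_const_prob {K : Type*} [HasConvexCombination K] (μ : ProbabilityMeasure X) :
    IsAffineMap fun _ : K => μ :=
  fun _ _ hw _ _ _ => isCombination_const hw μ

end Mixture

theorem integral_diracProb {X : Type*} [TopologicalSpace X] [MeasurableSpace X] [BorelSpace X]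
    [T1Space X] (f : C(X, ℝ)) (x : X) : ∫ z, f z ∂(diracProb x : Measure X) = f x := by
  change ∫ z, f z ∂(Measure.dirac x) = f x
  rw [integral_dirac]

section Topological

variable {X : Type*} [TopologicalSpace X] [CompactSpace X] [MeasurableSpace X]
  [BorelSpace X]

theorem integrable_continuousMap {E : Type*} [NormedAddCommGroup E]
    [SecondCountableTopologyEither X E] (f : C(X, E)) (μ : Measure X) [IsFiniteMeasure μ] :
    Integrable f μ := by
  refine Integrable.of_bound f.continuous.aestronglyMeasurable ‖f‖ (ae_of_all _ f.norm_coe_le_norm)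

theorem integral_atomic [T1Space X] {n : ℕ} {w : Fin n → ℝ}
    (hw : w ∈ stdSimplex ℝ (Fin n)) (x : Fin n → X) (f : C(X, ℝ)) :
    ∫ z, f z ∂(atomic hw x : Measure X) = ∑ i, w i * f (x i) := by
  rw [atomic, integral_mixture hw _ fun i => integrable_continuousMap f _]
  simp only [integral_diracProb, smul_eq_mul]

end Topological

theorem ext_of_integral_continuousMap {X : Type*} [MetricSpace X] [CompactSpace X]
    [MeasurableSpace X] [BorelSpace X] {μ ν : ProbabilityMeasure X}
    (h : ∀ f : C(X, ℝ), ∫ z, f z ∂(μ : Measure X) = ∫ z, f z ∂(ν : Measure X)) : μ = ν :=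
  ProbabilityMeasure.toMeasure_injective
    (ext_of_forall_integral_eq_of_IsFiniteMeasure fun f => h f.toContinuousMap)

/-! ### Partitions of unity and finitely supported approximations -/

theorem exists_partition_of_net {X : Type*} [MetricSpace X] {n : ℕ} {x : Fin n → X} {δ : ℝ}
    (hx : ∀ z, ∃ i, dist z (x i) < δ) :
    ∃ φ : Fin n → C(X, ℝ), (∀ z, (fun i => φ i z) ∈ stdSimplex ℝ (Fin n)) ∧
      ∀ i z, φ i z ≠ 0 → dist z (x i) < δ := by
  let ψ : Fin n → X → ℝ := fun i z => max 0 (δ - dist z (x i))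
  have hψ : ∀ i, Continuous (ψ i) := fun i => by fun_prop
  have hψ0 : ∀ i z, 0 ≤ ψ i z := fun i z => le_max_left _ _
  have hpos : ∀ z, 0 < ∑ i, ψ i z := fun z => by
    obtain ⟨i, hi⟩ := hx z
    exact Finset.sum_pos' (fun j _ => hψ0 j z)
      ⟨i, Finset.mem_univ _, lt_max_of_lt_right (sub_pos.2 hi)⟩
  refine ⟨fun i => ⟨fun z => ψ i z / ∑ j, ψ j z, ?_⟩, fun z => ⟨fun i => ?_, ?_⟩, fun i z h => ?_⟩
  · exact (hψ i).div (continuous_finsetSum _ fun j _ => hψ j) fun z => (hpos z).ne'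
  · exact div_nonneg (hψ0 i z) (hpos z).le
  · simp only [ContinuousMap.coe_mk]
    rw [← Finset.sum_div, div_self (hpos z).ne']
  · by_contra hc
    refine h ?_
    simp only [ContinuousMap.coe_mk, ψ]
    rw [max_eq_left (by linarith), zero_div]

theorem integral_mem_stdSimplex {X : Type*} [TopologicalSpace X] [CompactSpace X]
    [MeasurableSpace X] [BorelSpace X] {n : ℕ} {φ : Fin n → C(X, ℝ)}
    (hφ : ∀ z, (fun i => φ i z) ∈ stdSimplex ℝ (Fin n)) (μ : ProbabilityMeasure X) :
    (fun i => ∫ z, φ i z ∂(μ : Measure X)) ∈ stdSimplex ℝ (Fin n) := by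
  refine ⟨fun i => integral_nonneg fun z => (hφ z).1 i, ?_⟩
  rw [← integral_finsetSum _ fun i _ => integrable_continuousMap _ _]
  simp [fun z => (hφ z).2]

section Smear

variable {X Y : Type*} [MetricSpace X] [CompactSpace X] [MeasurableSpace X] [BorelSpace X]
  [MetricSpace Y] [CompactSpace Y] [MeasurableSpace Y] [BorelSpace Y] {n : ℕ}
  {φ : Fin n → C(X, ℝ)}

/-- The affine map `μ ↦ ∑ i, μ(φ i) • δ (y i)` given by a partition of unity `φ`. -/
noncomputable def smear (hφ : ∀ z, (fun i => φ i z) ∈ stdSimplex ℝ (Fin n)) (y : Fin n → Y)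
    (μ : ProbabilityMeasure X) : ProbabilityMeasure Y :=
  atomic (integral_mem_stdSimplex hφ μ) y

theorem integral_smear (hφ : ∀ z, (fun i => φ i z) ∈ stdSimplex ℝ (Fin n)) (y : Fin n → Y)
    (μ : ProbabilityMeasure X) (f : C(Y, ℝ)) :
    ∫ z, f z ∂(smear hφ y μ : Measure Y) = ∑ i, (∫ z, φ i z ∂(μ : Measure X)) * f (y i) :=
  integral_atomic _ _ _

theorem continuous_smear (hφ : ∀ z, (fun i => φ i z) ∈ stdSimplex ℝ (Fin n)) (y : Fin n → Y) :
    Continuous (smear hφ y) := by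
  rw [ProbabilityMeasure.continuous_iff_forall_continuousMap_continuous_integral]
  intro f
  simp only [integral_smear]
  exact continuous_finsetSum _ fun i _ =>
    (ProbabilityMeasure.continuous_integral_continuousMap (φ i)).mul continuous_const

theorem isAffineMap_smear (hφ : ∀ z, (fun i => φ i z) ∈ stdSimplex ℝ (Fin n)) (y : Fin n → Y) :
    IsAffineMap (smear hφ y) := by
  intro m w hw σ s hs
  rw [eq_mixture_of_isCombination hw hs]
  have : smear hφ y (mixture hw σ) = mixture hw fun i => smear hφ y (σ i) := by
    refine ext_of_integral_continuousMap fun f => ?_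
    rw [integral_mixture hw _ fun i => integrable_continuousMap f _, integral_smear]
    simp only [integral_smear, integral_mixture hw _ fun i => integrable_continuousMap _ _,
      Finset.sum_mul, Finset.mul_sum, smul_eq_mul]
    rw [Finset.sum_comm]
    simp only [mul_assoc]
  rw [this]
  exact isCombination_mixture hw _

theorem exists_fin_net (X : Type*) [MetricSpace X] [CompactSpace X] {δ : ℝ} (hδ : 0 < δ) :
    ∃ (n : ℕ) (x : Fin n → X), Function.Injective x ∧ ∀ z, ∃ i, dist z (x i) < δ := by
  obtain ⟨t, -, ht, hcov⟩ := finite_cover_balls_of_compact (isCompact_univ (X := X)) hδ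
  have : Fintype t := ht.fintype
  let e := (Fintype.equivFin t).symm
  refine ⟨_, fun i => (e i : X), Subtype.val_injective.comp e.injective, fun z => ?_⟩
  obtain ⟨y, hy, hz⟩ := Set.mem_iUnion₂.1 (hcov (Set.mem_univ z))
  exact ⟨e.symm ⟨y, hy⟩, by simpa using hz⟩

/-- A closed set that contains all finitely supported measures contains all measures. -/
theorem mem_of_forall_atomic_mem {C : Set (ProbabilityMeasure X)} (hC : IsClosed C)
    (h : ∀ (n : ℕ) (w : Fin n → ℝ) (hw : w ∈ stdSimplex ℝ (Fin n)) (x : Fin n → X),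
      atomic hw x ∈ C) (μ : ProbabilityMeasure X) : μ ∈ C := by
  choose n x _ hx using fun k : ℕ => exists_fin_net X (Nat.one_div_pos_of_nat (n := k) (α := ℝ))
  choose φ hφ hφx using fun k => exists_partition_of_net (hx k)
  -- Smearing along finer and finer nets converges weakly to `μ`, because each test function is
  -- uniformly continuous.
  refine hC.mem_of_tendsto (b := atTop) (f := fun k => smear (hφ k) (x k) μ) ?_
    (Eventually.of_forall fun k => h _ _ _ _)
  rw [ProbabilityMeasure.tendsto_iff_forall_integral_tendsto]
  intro f
  have hf : UniformContinuous f := CompactSpace.uniformContinuous_of_continuous f.continuous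
  rw [Metric.tendsto_atTop]
  intro ε hε
  obtain ⟨δ, hδ, hfδ⟩ := Metric.uniformContinuous_iff.1 hf (ε / 2) (half_pos hε)
  obtain ⟨N, hN⟩ := exists_nat_one_div_lt hδ
  refine ⟨N, fun k hk => ?_⟩
  have hk' : 1 / ((k : ℝ) + 1) < δ := (Nat.one_div_le_one_div hk).trans_lt hN
  have e1 := integral_smear (hφ k) (x k) μ f.toContinuousMap
  change ∫ z, f z ∂(smear (hφ k) (x k) μ : Measure X) = _ at e1
  have hint : ∀ i, Integrable (fun z => φ k i z * f (x k i)) (μ : Measure X) := fun i =>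
    (integrable_continuousMap (φ k i) _).mul_const _
  have e2 : ∑ i, (∫ z, φ k i z ∂(μ : Measure X)) * f (x k i)
      = ∫ z, ∑ i, φ k i z * f (x k i) ∂(μ : Measure X) := by
    rw [integral_finsetSum _ fun i _ => hint i]
    simp only [integral_mul_const]
  rw [Real.dist_eq, e1]
  change |∑ i, (∫ z, φ k i z ∂(μ : Measure X)) * f (x k i) - _| < ε
  have hfi : Integrable f (μ : Measure X) := integrable_continuousMap f.toContinuousMap _
  rw [e2, ← integral_sub (integrable_finsetSum _ fun i _ => hint i) hfi]
  refine lt_of_le_of_lt ?_ (half_lt_self hε)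
  have hb : ∀ z, ‖∑ i, φ k i z * f (x k i) - f z‖ ≤ ε / 2 := fun z => by
    have : ∑ i, φ k i z * f (x k i) - f z = ∑ i, φ k i z * (f (x k i) - f z) := by
      simp only [mul_sub, Finset.sum_sub_distrib, ← Finset.sum_mul, (hφ k z).2, one_mul]
    rw [this]
    calc ‖∑ i, φ k i z * (f (x k i) - f z)‖ ≤ ∑ i, ‖φ k i z * (f (x k i) - f z)‖ :=
          norm_sum_le _ _
      _ ≤ ∑ i, φ k i z * (ε / 2) := Finset.sum_le_sum fun i _ => by
          rw [norm_mul, Real.norm_of_nonneg ((hφ k z).1 i)]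
          by_cases h0 : φ k i z = 0
          · simp [h0]
          · refine mul_le_mul_of_nonneg_left ?_ ((hφ k z).1 i)
            rw [← dist_eq_norm, dist_comm]
            exact (hfδ ((hφx k i z h0).trans hk')).le
      _ = ε / 2 := by rw [← Finset.sum_mul, (hφ k z).2, one_mul]
  simpa using norm_integral_le_of_norm_le_const (μ := (μ : Measure X)) (ae_of_all _ hb)

end Smear

/-! ### Metrics that induce a given topology -/

theorem IsMetricOn.self {K : Type*} {d : K → K → ℝ} (h : IsMetricOn d) (x : K) : d x x = 0 :=
  (h.eq_zero_iff x x).2 rfl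

theorem IsMetricOn.nonneg {K : Type*} {d : K → K → ℝ} (h : IsMetricOn d) (x y : K) :
    0 ≤ d x y := by
  have := h.triangle x y x
  rw [h.self, h.symm y x] at this
  linarith

theorem IsModulus.exists_pos_lt {h : ℝ → ℝ} (hh : IsModulus h) {ε : ℝ} (hε : 0 < ε) :
    ∃ δ > 0, h δ < ε := by
  obtain ⟨δ, h1, h2⟩ := ((hh.tendsto_zero.eventually_lt_const hε).and self_mem_nhdsWithin).exists
  exact ⟨δ, h2, h1⟩

/-- `d` is a metric on the topological space `K` that induces its topology. -/
structure InducesTopology {K : Type*} [TopologicalSpace K] (d : K → K → ℝ) : Prop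
    extends IsMetricOn d where
  isOpen_iff : ∀ s : Set K, IsOpen s ↔ ∀ x ∈ s, ∃ ε > 0, ∀ y, d x y < ε → y ∈ s

namespace InducesTopology

variable {K : Type*} [TopologicalSpace K] {d : K → K → ℝ}

/-- The metric space structure defined by `d`. -/
@[reducible] noncomputable def metricSpace (h : InducesTopology d) : MetricSpace K :=
  MetricSpace.ofDistTopology d h.self h.symm h.triangle h.isOpen_iff
    fun x y => (h.eq_zero_iff x y).1

theorem continuous (h : InducesTopology d) : Continuous fun p : K × K => d p.1 p.2 :=
  letI := h.metricSpace
  continuous_dist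

theorem tendsto_iff (h : InducesTopology d) {ι : Type*} {u : ι → K} {l : Filter ι} {x : K} :
    Tendsto u l (𝓝 x) ↔ Tendsto (fun i => d (u i) x) l (𝓝 0) :=
  letI := h.metricSpace
  tendsto_iff_dist_tendsto_zero

theorem t2Space (h : InducesTopology d) : T2Space K :=
  letI := h.metricSpace
  inferInstance

theorem exists_bound [CompactSpace K] (h : InducesTopology d) : ∃ C, ∀ x y, d x y ≤ C := by
  obtain ⟨C, hC⟩ := (isCompact_range h.continuous).bddAbove
  exact ⟨C, fun x y => hC ⟨(x, y), rfl⟩⟩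

theorem exists_finite_net [CompactSpace K] (h : InducesTopology d) {ε : ℝ} (hε : 0 < ε) :
    ∃ t : Finset K, ∀ x, ∃ z ∈ t, d x z < ε := by
  let _ := h.metricSpace
  obtain ⟨t, -, ht, hcov⟩ := finite_cover_balls_of_compact (isCompact_univ (X := K)) hε
  refine ⟨ht.toFinset, fun x => ?_⟩
  obtain ⟨z, hz, hx⟩ := Set.mem_iUnion₂.1 (hcov (Set.mem_univ x))
  exact ⟨z, ht.mem_toFinset.2 hz, hx⟩

theorem continuous_of_isometry (h : InducesTopology d) {L : Type*} [TopologicalSpace L]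
    {d' : L → L → ℝ} (h' : InducesTopology d') {f : K → L} (hf : ∀ x y, d' (f x) (f y) = d x y) :
    Continuous f := by
  rw [continuous_iff_continuousAt]
  intro x
  rw [ContinuousAt, h'.tendsto_iff]
  simp only [hf]
  exact h.tendsto_iff.1 tendsto_id

theorem of_homeomorph (h : InducesTopology d) {L : Type*} [TopologicalSpace L] (e : K ≃ₜ L)
    {d' : L → L → ℝ} (hd : ∀ x y, d' (e x) (e y) = d x y) : InducesTopology d' := by
  have hd' : ∀ x y, d' x y = d (e.symm x) (e.symm y) := fun x y => by
    rw [← hd, e.apply_symm_apply, e.apply_symm_apply]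
  refine ⟨⟨fun x y => ?_, fun x y => ?_, fun x y z => ?_⟩, fun s => ?_⟩
  · rw [hd', h.eq_zero_iff, e.symm.injective.eq_iff]
  · rw [hd', hd', h.symm]
  · simp only [hd']
    exact h.triangle _ _ _
  · rw [← e.isOpen_preimage, h.isOpen_iff, e.symm.surjective.forall]
    refine forall_congr' fun x => ?_
    simp only [Set.mem_preimage, e.apply_symm_apply, e.symm.surjective.forall, hd']

end InducesTopology

/-- On a finitely supported measure, `F` and `G` take convex combinations, with equal weights, of
their values at Dirac measures, so quasiconvexity applies; density and continuity do the rest. One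
application of `h` is the price for passing from points to measures. -/
theorem IsQuasiconvexWith.le_of_forall_dirac {X : Type*} [MetricSpace X] [CompactSpace X]
    [MeasurableSpace X] [BorelSpace X] {K : Type*} [TopologicalSpace K] [HasConvexCombination K]
    {d : K → K → ℝ} (hd : InducesTopology d) {h : ℝ → ℝ} (hh : IsModulus h)
    (hq : IsQuasiconvexWith d h) {F G : ProbabilityMeasure X → K} (hF : Continuous F)
    (hF' : IsAffineMap F) (hG : Continuous G) (hG' : IsAffineMap G) {c : ℝ} (hc : 0 ≤ c)
    (hFG : ∀ x, d (F (diracProb x)) (G (diracProb x)) ≤ c) (μ : ProbabilityMeasure X) :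
    d (F μ) (G μ) ≤ h c := by
  refine mem_of_forall_atomic_mem (C := {μ | d (F μ) (G μ) ≤ h c})
    (isClosed_le (hd.continuous.comp (hF.prodMk hG)) continuous_const) (fun n w hw x => ?_) μ
  refine (hq n w hw _ _ _ _ (hF'.map_mixture hw _) (hG'.map_mixture hw _)).trans
    (hh.mono (Real.iSup_nonneg fun i => hd.nonneg _ _) hc (Real.iSup_le (fun i => hFG _) hc))

theorem smear_diracProb {X Y : Type*} [MetricSpace X] [CompactSpace X] [MeasurableSpace X]
    [BorelSpace X] [MetricSpace Y] [CompactSpace Y] [MeasurableSpace Y] [BorelSpace Y]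
    {n : ℕ} {φ : Fin n → C(X, ℝ)} (hφ : ∀ z, (fun i => φ i z) ∈ stdSimplex ℝ (Fin n))
    (y : Fin n → Y) (z : X) : smear hφ y (diracProb z) = atomic (hφ z) y := by
  refine ext_of_integral_continuousMap fun f => ?_
  simp only [integral_smear, integral_atomic, integral_diracProb]

theorem map_atomic {X Y : Type*} [MetricSpace X] [CompactSpace X] [MeasurableSpace X]
    [BorelSpace X] [MetricSpace Y] [CompactSpace Y] [MeasurableSpace Y] [BorelSpace Y]
    {n : ℕ} {w : Fin n → ℝ} (hw : w ∈ stdSimplex ℝ (Fin n)) (x : Fin n → X) {f : X → Y}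
    (hf : Continuous f) :
    (atomic hw x).map hf.measurable.aemeasurable = atomic hw fun i => f (x i) := by
  refine ext_of_integral_continuousMap fun g => ?_
  rw [ProbabilityMeasure.toMeasure_map, integral_map hf.measurable.aemeasurable
    g.continuous.aestronglyMeasurable, integral_atomic]
  exact integral_atomic hw x (g.comp ⟨f, hf⟩)

/-! ### Estimates for `Ω.distance` -/

section Distance

variable (Ω : QuasiWassersteinMetric.{u}) {X Y : Type u}
  [MetricSpace X] [CompactSpace X] [Nonempty X] [MeasurableSpace X] [BorelSpace X]
  [MetricSpace Y] [CompactSpace Y] [Nonempty Y] [MeasurableSpace Y] [BorelSpace Y]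

namespace QuasiWassersteinMetric

theorem inducesTopology (hX : Metric.ediam (Set.univ : Set X) ≤ Ω.D) :
    InducesTopology (Ω.distance X) :=
  { Ω.isMetric X hX with isOpen_iff := Ω.topology X hX }

/-- Comparing the identity with a constant map to a Dirac measure shows that every measure is within
`h M` of that Dirac measure. The bound depends on the space only through `M` and `h`. -/
theorem distance_le_of_dist_le (hX : Metric.ediam (Set.univ : Set X) ≤ Ω.D) {h : ℝ → ℝ}
    (hh : IsModulus h) (hq : IsQuasiconvexWith (Ω.distance X) h) {M : ℝ}
    (hM : ∀ x y : X, dist x y ≤ M) (μ ν : ProbabilityMeasure X) :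
    Ω.distance X μ ν ≤ 2 * h M := by
  have hΩ := Ω.inducesTopology hX
  obtain ⟨x⟩ := ‹Nonempty X›
  have hM0 : 0 ≤ M := dist_nonneg.trans (hM x x)
  have key : ∀ μ, Ω.distance X μ (diracProb x) ≤ h M := fun μ =>
    hq.le_of_forall_dirac hΩ hh (F := fun μ => μ) continuous_id IsAffineMap.id continuous_const
      (isAffineMap_const_prob (diracProb x)) hM0 (fun y => by rw [Ω.dirac X hX]; exact hM y x) μ
  have := hΩ.triangle μ (diracProb x) ν
  rw [hΩ.symm (diracProb x) ν] at this
  linarith [key μ, key ν]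

/-- The inner `h` bounds how far a single Dirac measure is moved, being spread over points within
`δ`; the outer one passes from Dirac measures to arbitrary ones. -/
theorem distance_smear_le (hX : Metric.ediam (Set.univ : Set X) ≤ Ω.D) {h : ℝ → ℝ}
    (hh : IsModulus h) (hq : IsQuasiconvexWith (Ω.distance X) h) {n : ℕ} {φ : Fin n → C(X, ℝ)}
    (hφ : ∀ z, (fun i => φ i z) ∈ stdSimplex ℝ (Fin n)) {x : Fin n → X} {δ : ℝ} (hδ : 0 ≤ δ)
    (hφx : ∀ i z, φ i z ≠ 0 → dist z (x i) < δ) (μ : ProbabilityMeasure X) :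
    Ω.distance X (smear hφ x μ) μ ≤ h (h δ) := by
  have hΩ := Ω.inducesTopology hX
  refine hq.le_of_forall_dirac hΩ hh (continuous_smear hφ x) (isAffineMap_smear hφ x)
    continuous_id IsAffineMap.id (hh.nonneg _ hδ) (fun z => ?_) μ
  classical
  -- The supremum in quasiconvexity also runs over indices of weight zero, whose `x i` may be far
  -- from `z`. Moving these atoms to `z` leaves the measure unchanged.
  have e : smear hφ x (diracProb z)
      = atomic (hφ z) fun i => if φ i z = 0 then z else x i := by
    rw [smear_diracProb]
    refine ext_of_integral_continuousMap fun f => ?_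
    simp only [integral_atomic]
    refine Finset.sum_congr rfl fun i _ => ?_
    by_cases h0 : φ i z = 0 <;> simp [h0]
  rw [e]
  refine (hq n _ (hφ z) _ _ _ _ (isCombination_mixture _ _) (isCombination_const (hφ z) _)).trans
    (hh.mono (Real.iSup_nonneg fun i => hΩ.nonneg _ _) hδ (Real.iSup_le (fun i => ?_) hδ))
  refine (Ω.dirac X hX _ z).trans_le ?_
  dsimp only
  split_ifs with h0
  · rwa [dist_self]
  · rw [dist_comm]
    exact (hφx i z h0).le

/-- The assignment `x i ↦ y i` is a `K`-Lipschitz map on the finite space of all `x i`. Pushing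
forward along it compares with `Y`, while the inclusion of the finite space into `X` loses nothing.
-/
theorem distance_atomic_le (hX : Metric.ediam (Set.univ : Set X) ≤ Ω.D)
    (hY : Metric.ediam (Set.univ : Set Y) ≤ Ω.D) {n : ℕ} {x : Fin n → X} {y : Fin n → Y}
    {K : ℝ≥0} (hK : 1 ≤ K) (hxy : ∀ i j, dist (y i) (y j) ≤ K * dist (x i) (x j))
    {v w : Fin n → ℝ} (hv : v ∈ stdSimplex ℝ (Fin n)) (hw : w ∈ stdSimplex ℝ (Fin n)) :
    Ω.distance Y (atomic hv y) (atomic hw y) ≤ K * Ω.distance X (atomic hv x) (atomic hw x) := by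
  let F : Type u := Set.range x
  have : CompactSpace F := isCompact_iff_compactSpace.1 (Set.finite_range x).isCompact
  have : Nonempty F := by
    rcases n with _ | n
    · simpa using hw.2
    · exact ⟨⟨x 0, 0, rfl⟩⟩
  let r : F → Y := fun p => y p.2.choose
  let x' : Fin n → F := fun i => ⟨x i, i, rfl⟩
  -- The chosen index may differ from `i`, but `hxy` forces `y` to agree wherever `x` does, so
  -- injectivity of `x` is not needed.
  have hr : ∀ i, r (x' i) = y i := fun i => by
    have h0 : x (x' i).2.choose = x i := (x' i).2.choose_spec
    have := hxy (x' i).2.choose i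
    rw [h0, dist_self, mul_zero] at this
    exact dist_le_zero.1 this
  have hrK : LipschitzWith K r := by
    refine LipschitzWith.of_dist_le_mul fun p q => ?_
    refine (hxy _ _).trans_eq ?_
    rw [p.2.choose_spec, q.2.choose_spec]
    rfl
  have hF : Metric.ediam (Set.univ : Set F) ≤ Ω.D := by
    rw [← (isometry_subtype_coe (s := Set.range x)).ediam_image Set.univ]
    exact (Metric.ediam_mono (Set.subset_univ _)).trans hX
  have h1 := Ω.pushforward_lipschitz F Y hF hY r K hK hrK (atomic hv x') (atomic hw x')
  have h2 := Ω.pushforward_isometry F X hF hX Subtype.val isometry_subtype_coe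
    (atomic hv x') (atomic hw x')
  rw [map_atomic _ _ hrK.continuous, map_atomic _ _ hrK.continuous] at h1
  rw [map_atomic _ _ continuous_subtype_val, map_atomic _ _ continuous_subtype_val] at h2
  rw [← h2] at h1
  simpa only [hr] using h1

end QuasiWassersteinMetric
end Distance

/-! ### Gromov-Hausdorff closeness implies almost isometry of the spaces of measures -/

theorem exists_correspondence_of_ghDist_lt {X Y : Type*} [MetricSpace X] [CompactSpace X]
    [Nonempty X] [MetricSpace Y] [CompactSpace Y] [Nonempty Y] {η : ℝ}
    (h : GromovHausdorff.ghDist X Y < η) :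
    ∃ R : X → Y → Prop, (∀ x, ∃ y, R x y) ∧ (∀ y, ∃ x, R x y) ∧
      ∀ x y x' y', R x y → R x' y' → |dist x x' - dist y y'| ≤ 2 * η := by
  let Φ := GromovHausdorff.optimalGHInjl X Y
  let Ψ := GromovHausdorff.optimalGHInjr X Y
  have hΦ : Isometry Φ := GromovHausdorff.isometry_optimalGHInjl X Y
  have hΨ : Isometry Ψ := GromovHausdorff.isometry_optimalGHInjr X Y
  have hH : Metric.hausdorffDist (Set.range Φ) (Set.range Ψ) < η := by
    rwa [GromovHausdorff.hausdorffDist_optimal]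
  have hfin : Metric.hausdorffEDist (Set.range Φ) (Set.range Ψ) ≠ ⊤ :=
    Metric.hausdorffEDist_ne_top_of_nonempty_of_bounded (Set.range_nonempty _)
      (Set.range_nonempty _) (isCompact_range hΦ.continuous).isBounded
      (isCompact_range hΨ.continuous).isBounded
  refine ⟨fun x y => dist (Φ x) (Ψ y) < η, fun x => ?_, fun y => ?_, fun x y x' y' h1 h2 => ?_⟩
  · obtain ⟨_, ⟨y, rfl⟩, hy⟩ := Metric.exists_dist_lt_of_hausdorffDist_lt
      (Set.mem_range_self x) hH hfin
    exact ⟨y, hy⟩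
  · obtain ⟨_, ⟨x, rfl⟩, hx⟩ := Metric.exists_dist_lt_of_hausdorffDist_lt'
      (Set.mem_range_self y) hH hfin
    exact ⟨x, hx⟩
  · rw [← hΦ.dist_eq, ← hΨ.dist_eq, ← Real.dist_eq]
    refine (dist_dist_dist_le _ _ _ _).trans ?_
    linarith

theorem exists_separation {X : Type*} [MetricSpace X] {n : ℕ} {x : Fin n → X}
    (hx : Function.Injective x) : ∃ s > 0, ∀ i j, i ≠ j → s ≤ dist (x i) (x j) := by
  classical
  -- The extra value at `none` makes the index type nonempty, so that a minimum exists even for `n =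
  -- 0`.
  let f : Option (Fin n × Fin n) → ℝ := fun p =>
    p.elim 1 fun p => if p.1 = p.2 then 1 else dist (x p.1) (x p.2)
  obtain ⟨p, hp⟩ := Finite.exists_min f
  refine ⟨f p, ?_, fun i j hij => (hp (some (i, j))).trans_eq (by simp [f, hij])⟩
  rcases p with _ | ⟨i, j⟩
  · simp [f]
  · by_cases hij : i = j
    · simp [f, hij]
    · simpa [f, hij] using hx.ne hij

section Approximation

variable (Ω : QuasiWassersteinMetric.{u})

/-- Mutually almost inverse affine almost isometries between `Prob(X)` and `Prob(Y)`. -/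
def AlmostIsometricProb (X Y : Type u)
    [MetricSpace X] [CompactSpace X] [Nonempty X] [MeasurableSpace X] [BorelSpace X]
    [MetricSpace Y] [CompactSpace Y] [Nonempty Y] [MeasurableSpace Y] [BorelSpace Y] (ε : ℝ) :
    Prop :=
  ∃ (f : ProbabilityMeasure X → ProbabilityMeasure Y)
    (g : ProbabilityMeasure Y → ProbabilityMeasure X),
    Continuous f ∧ IsAffineMap f ∧ Continuous g ∧ IsAffineMap g ∧
    (∀ μ ν, |Ω.distance Y (f μ) (f ν) - Ω.distance X μ ν| < ε) ∧
    (∀ μ ν, |Ω.distance X (g μ) (g ν) - Ω.distance Y μ ν| < ε) ∧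
    (∀ ν, Ω.distance Y (f (g ν)) ν < ε) ∧ ∀ μ, Ω.distance X (g (f μ)) μ < ε

variable {X Y : Type u}
  [MetricSpace X] [CompactSpace X] [Nonempty X] [MeasurableSpace X] [BorelSpace X]
  [MetricSpace Y] [CompactSpace Y] [Nonempty Y] [MeasurableSpace Y] [BorelSpace Y]

namespace QuasiWassersteinMetric

section

variable (hX : Metric.ediam (Set.univ : Set X) ≤ Ω.D) (hY : Metric.ediam (Set.univ : Set Y) ≤ Ω.D)
  {h : ℝ → ℝ} (hh : IsModulus h) (hqX : IsQuasiconvexWith (Ω.distance X) h)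
  (hqY : IsQuasiconvexWith (Ω.distance Y) h) {δ : ℝ} (hδ : 0 ≤ δ) {n : ℕ} {x : Fin n → X}
  {y : Fin n → Y} {K : ℝ≥0} (hK : 1 ≤ K) (hxy : ∀ i j, dist (y i) (y j) ≤ K * dist (x i) (x j))
  (hyx : ∀ i j, dist (x i) (x j) ≤ K * dist (y i) (y j)) {φ : Fin n → C(X, ℝ)}
  (hφ : ∀ z, (fun i => φ i z) ∈ stdSimplex ℝ (Fin n)) (hφx : ∀ i z, φ i z ≠ 0 → dist z (x i) < δ)
  {ψ : Fin n → C(Y, ℝ)} (hψ : ∀ z, (fun i => ψ i z) ∈ stdSimplex ℝ (Fin n))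
  (hψy : ∀ i z, ψ i z ≠ 0 → dist z (y i) < δ) {C : ℝ}

include hX hY hh hqX hδ hK hxy hyx hφx in
-- Going from `μ`, `ν` to their smears over `x` costs `h (h δ)` at each end. From `x` to `y` the
-- distance changes by a factor between `1 / K` and `K`, hence by at most `(K - 1) * C`.
theorem abs_distance_smear_sub_le (hCX : ∀ μ ν, Ω.distance X μ ν ≤ C)
    (hCY : ∀ μ ν, Ω.distance Y μ ν ≤ C) (μ ν : ProbabilityMeasure X) :
    |Ω.distance Y (smear hφ y μ) (smear hφ y ν) - Ω.distance X μ ν|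
      ≤ 2 * h (h δ) + (K - 1) * C := by
  have hm := Ω.isMetric X hX
  have hK' : (1 : ℝ) ≤ K := hK
  have e1 := Ω.distance_smear_le hX hh hqX hφ hδ hφx μ
  have e2 := Ω.distance_smear_le hX hh hqX hφ hδ hφx ν
  have p1 := Ω.distance_atomic_le hX hY hK hxy (integral_mem_stdSimplex hφ μ)
    (integral_mem_stdSimplex hφ ν)
  have p2 := Ω.distance_atomic_le hY hX hK hyx (integral_mem_stdSimplex hφ μ)
    (integral_mem_stdSimplex hφ ν)
  change Ω.distance Y (smear hφ y μ) (smear hφ y ν)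
    ≤ K * Ω.distance X (smear hφ x μ) (smear hφ x ν) at p1
  change Ω.distance X (smear hφ x μ) (smear hφ x ν)
    ≤ K * Ω.distance Y (smear hφ y μ) (smear hφ y ν) at p2
  have c1 := mul_le_mul_of_nonneg_left (hCX (smear hφ x μ) (smear hφ x ν)) (sub_nonneg.2 hK')
  have c2 := mul_le_mul_of_nonneg_left (hCY (smear hφ y μ) (smear hφ y ν)) (sub_nonneg.2 hK')
  have t1 := hm.triangle (smear hφ x μ) μ (smear hφ x ν)
  have t2 := hm.triangle μ ν (smear hφ x ν)
  have t3 := hm.triangle μ (smear hφ x μ) ν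
  have t4 := hm.triangle (smear hφ x μ) (smear hφ x ν) ν
  rw [hm.symm ν] at t2
  rw [hm.symm μ (smear hφ x μ)] at t3
  rw [abs_le]
  constructor <;> linarith

include hX hY hh hqX hqY hδ hK hxy hφx hψy in
-- The intermediate point is `smear hψ y ν`. Its distance to the composite is compared, with factor
-- `K`, to the effect of smearing `smear hψ x ν` over `x` within `X`; its distance to `ν` is a
-- smearing error in `Y`.
theorem distance_smear_smear_le (ν : ProbabilityMeasure Y) :
    Ω.distance Y (smear hφ y (smear hψ x ν)) ν ≤ (1 + K) * h (h δ) := by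
  have e1 := Ω.distance_smear_le hX hh hqX hφ hδ hφx (smear hψ x ν)
  have e2 := Ω.distance_smear_le hY hh hqY hψ hδ hψy ν
  have p1 := Ω.distance_atomic_le hX hY hK hxy (integral_mem_stdSimplex hφ (smear hψ x ν))
    (integral_mem_stdSimplex hψ ν)
  change Ω.distance Y (smear hφ y (smear hψ x ν)) (smear hψ y ν)
    ≤ K * Ω.distance X (smear hφ x (smear hψ x ν)) (smear hψ x ν) at p1
  have t := (Ω.isMetric Y hY).triangle (smear hφ y (smear hψ x ν)) (smear hψ y ν) ν
  have := mul_le_mul_of_nonneg_left e1 K.coe_nonneg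
  linarith

end

theorem exists_almostIsometricProb (X : Type u) [MetricSpace X] [CompactSpace X] [Nonempty X]
    [MeasurableSpace X] [BorelSpace X] (hX : Metric.ediam (Set.univ : Set X) ≤ Ω.D) {ε : ℝ}
    (hε : 0 < ε) : ∃ η > 0, ∀ (Y : Type u) [MetricSpace Y] [CompactSpace Y] [Nonempty Y]
      [MeasurableSpace Y] [BorelSpace Y], Metric.ediam (Set.univ : Set Y) ≤ Ω.D →
      GromovHausdorff.ghDist X Y < η → AlmostIsometricProb Ω X Y ε := by
  -- The slack 2 leaves room for the distortion `2 * η ≤ 1`, so that `M` also bounds the diameter of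
  -- every admissible `Y`, and a single `h` serves both spaces.
  let M : ℝ := Metric.diam (Set.univ : Set X) + 2
  have hM : 0 < M := by positivity
  have hXb : ∀ a b : X, dist a b ≤ M - 2 := fun a b => by
    simpa [M] using Metric.dist_le_diam_of_mem isCompact_univ.isBounded (Set.mem_univ a)
      (Set.mem_univ b)
  obtain ⟨h, hh, hq⟩ := Ω.quasiconvex M hM
  let C : ℝ := 2 * h M
  have hC : 0 ≤ C := mul_nonneg zero_le_two (hh.nonneg _ hM.le)
  obtain ⟨δ', hδ', hhδ'⟩ := hh.exists_pos_lt (ε := ε / 12) (by positivity)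
  obtain ⟨δ, hδ, hhδ⟩ := hh.exists_pos_lt hδ'
  have he : h (h δ) < ε / 12 := (hh.mono (hh.nonneg _ hδ.le) hδ'.le hhδ.le).trans_lt hhδ'
  have he0 : 0 ≤ h (h δ) := hh.nonneg _ (hh.nonneg _ hδ.le)
  obtain ⟨n, x, hxinj, hx⟩ := exists_fin_net X (half_pos hδ)
  obtain ⟨s, hs, hsx⟩ := exists_separation hxinj
  let κ : ℝ := min 1 (ε / (2 * (C + 1)))
  have hκ : 0 < κ := by positivity
  -- The three bounds keep the diameter of `Y` below `M`, carry the `δ / 2`-net of `X` to a `δ`-net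
  -- of `Y`, and make the additive distortion small against the separation `s` of the net, so that
  -- it becomes a factor `1 + κ`.
  let η : ℝ := min (1 / 2) (min (δ / 4) (s * κ / 4))
  have hη : 0 < η := by positivity
  have hη1 : 2 * η ≤ 1 := by linarith [min_le_left (1 / 2) (min (δ / 4) (s * κ / 4))]
  have hη2 : 2 * η ≤ δ / 2 := by
    linarith [(min_le_right (1 / 2) (min (δ / 4) (s * κ / 4))).trans (min_le_left _ _)]
  have hη3 : 2 * η ≤ s * κ / 2 := by
    linarith [(min_le_right (1 / 2) (min (δ / 4) (s * κ / 4))).trans (min_le_right _ _)]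
  refine ⟨η, hη, fun Y _ _ _ _ _ hY hXY => ?_⟩
  obtain ⟨R, hR1, hR2, hR⟩ := exists_correspondence_of_ghDist_lt hXY
  choose y hy using fun i => hR1 (x i)
  have hYb : ∀ a b : Y, dist a b ≤ M := fun a b => by
    obtain ⟨a', ha⟩ := hR2 a
    obtain ⟨b', hb⟩ := hR2 b
    linarith [(abs_le.1 (hR _ _ _ _ ha hb)).1, hXb a' b']
  have hed : ∀ (Z : Type u) [MetricSpace Z], (∀ a b : Z, dist a b ≤ M) →
      Metric.ediam (Set.univ : Set Z) ≤ ENNReal.ofReal M := fun Z _ hZ =>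
    Metric.ediam_le fun a _ b _ => by
      rw [edist_dist]
      exact ENNReal.ofReal_le_ofReal (hZ a b)
  have hXb' : ∀ a b : X, dist a b ≤ M := fun a b => (hXb a b).trans (by linarith)
  have hqX := hq X hX (hed X hXb')
  have hqY := hq Y hY (hed Y hYb)
  have hy' : ∀ z, ∃ i, dist z (y i) < δ := fun z => by
    obtain ⟨z', hz⟩ := hR2 z
    obtain ⟨i, hi⟩ := hx z'
    exact ⟨i, by linarith [(abs_le.1 (hR _ _ _ _ hz (hy i))).1]⟩
  have hx' : ∀ z, ∃ i, dist z (x i) < δ := fun z =>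
    (hx z).imp fun i hi => hi.trans (half_lt_self hδ)
  obtain ⟨φ, hφ, hφx⟩ := exists_partition_of_net hx'
  obtain ⟨ψ, hψ, hψy⟩ := exists_partition_of_net hy'
  let K : ℝ≥0 := 1 + ⟨κ, hκ.le⟩
  have hKκ : (K : ℝ) = 1 + κ := rfl
  have hK : 1 ≤ K := le_add_of_nonneg_right zero_le
  have hκ1 : κ ≤ 1 := min_le_left _ _
  have hsκ : s * κ ≤ s := by nlinarith
  have hxy : ∀ i j, dist (y i) (y j) ≤ K * dist (x i) (x j) := fun i j => by
    by_cases hij : i = j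
    · simp [hij]
    · have h1 := (abs_le.1 (hR _ _ _ _ (hy i) (hy j))).1
      have h2 := mul_le_mul_of_nonneg_right (hsx i j hij) hκ.le
      rw [hKκ]
      nlinarith
  have hyx : ∀ i j, dist (x i) (x j) ≤ K * dist (y i) (y j) := fun i j => by
    by_cases hij : i = j
    · simp [hij]
    · have h1 := (abs_le.1 (hR _ _ _ _ (hy i) (hy j))).2
      have h3 : s / 2 ≤ dist (y i) (y j) := by linarith [hsx i j hij]
      have h2 := mul_le_mul_of_nonneg_right h3 hκ.le
      rw [hKκ]
      nlinarith
  have hCX := Ω.distance_le_of_dist_le hX hh hqX hXb'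
  have hCY := Ω.distance_le_of_dist_le hY hh hqY hYb
  have hκC : κ * C < ε / 2 := by
    have h1 : κ * (C + 1) ≤ ε / (2 * (C + 1)) * (C + 1) :=
      mul_le_mul_of_nonneg_right (min_le_right _ _) (by positivity)
    have h2 : ε / (2 * (C + 1)) * (C + 1) = ε / 2 := by field_simp
    nlinarith
  have b1 : 2 * h (h δ) + (K - 1) * C < ε := by rw [hKκ]; linarith
  have b2 : (1 + K) * h (h δ) < ε := by rw [hKκ]; nlinarith
  exact ⟨smear hφ y, smear hψ x, continuous_smear _ _, isAffineMap_smear _ _,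
    continuous_smear _ _, isAffineMap_smear _ _,
    fun μ ν => (Ω.abs_distance_smear_sub_le hX hY hh hqX hδ.le hK hxy hyx hφ hφx hCX hCY
      μ ν).trans_lt b1,
    fun μ ν => (Ω.abs_distance_smear_sub_le hY hX hh hqY hδ.le hK hyx hxy hψ hψy hCY hCX
      μ ν).trans_lt b1,
    fun ν => (Ω.distance_smear_smear_le hX hY hh hqX hqY hδ.le hK hxy hφ hφx hψ hψy ν).trans_lt b2,
    fun μ => (Ω.distance_smear_smear_le hY hX hh hqY hqX hδ.le hK hyx hψ hψy hφ hφx μ).trans_lt b2⟩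

end QuasiWassersteinMetric
end Approximation

/-! ### Convex combinations of tracial states -/

section Trace

variable {A B : Type u} [CStarAlgebra A] [CStarAlgebra B]

theorem TraceSpace.continuous_eval (a : A) : Continuous fun σ : TraceSpace A => σ.1 a :=
  (WeakDual.eval_continuous a).comp continuous_subtype_val

theorem TraceSpace.isCombination_unique {n : ℕ} {w : Fin n → ℝ} {σ : Fin n → TraceSpace A}
    {s t : TraceSpace A} (hs : HasConvexCombination.IsCombination w σ s)
    (ht : HasConvexCombination.IsCombination w σ t) : s = t :=
  Subtype.ext (DFunLike.ext _ _ fun a => (hs a).trans (ht a).symm)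

/-- Used to see that pointwise limits of affine maps are affine. -/
theorem TraceSpace.isCombination_of_tendsto {ι : Type*} {l : Filter ι} [l.NeBot] {n : ℕ}
    {w : Fin n → ℝ} {u : ι → Fin n → TraceSpace A} {v : ι → TraceSpace A}
    {σ : Fin n → TraceSpace A} {s : TraceSpace A}
    (h : ∀ i, HasConvexCombination.IsCombination w (u i) (v i))
    (hu : ∀ j, Tendsto (fun i => u i j) l (𝓝 (σ j))) (hv : Tendsto v l (𝓝 s)) :
    HasConvexCombination.IsCombination w σ s := by
  intro a
  refine tendsto_nhds_unique (((continuous_eval a).tendsto s).comp hv) ?_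
  refine (tendsto_finsetSum Finset.univ fun j _ =>
    (((continuous_eval a).tendsto (σ j)).comp (hu j)).const_mul (w j : ℂ)).congr fun i => ?_
  exact (h i a).symm

theorem isAffineMap_const_trace {K : Type*} [HasConvexCombination K] (s : TraceSpace A) :
    IsAffineMap fun _ : K => s := by
  intro n w hw _ _ _ a
  dsimp only
  rw [← Finset.sum_mul]
  have : ∑ i, (w i : ℂ) = 1 := by exact_mod_cast hw.2
  rw [this, one_mul]

theorem IsAffineMap.symm_of_trace {X : Type*} [MeasurableSpace X]
    {e : ProbabilityMeasure X ≃ TraceSpace A} (he : IsAffineMap e) : IsAffineMap e.symm := by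
  intro n w hw σ s hs
  have h1 := he.map_mixture hw fun i => e.symm (σ i)
  simp only [e.apply_symm_apply] at h1
  rw [TraceSpace.isCombination_unique hs h1, e.symm_apply_apply]
  exact isCombination_mixture hw _

/-! ### Properties of the gap -/

variable {ω : TraceSpace A → TraceSpace A → ℝ} {ω' : TraceSpace B → TraceSpace B → ℝ}

theorem almostIsometries_mono {ε ε' : ℝ} (h : ε ≤ ε') :
    almostIsometries ω ω' ε ⊆ almostIsometries ω ω' ε' := by
  rintro f ⟨h1, h2, h3, g, h4, h5, h6⟩
  exact ⟨h1, h2, fun σ τ => (h3 σ τ).trans_le h, g, h4, h5, fun τ => (h6 τ).trans_le h⟩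

theorem gapSet_comm : gapSet ω ω' = gapSet ω' ω := by
  ext ε
  simp only [gapSet, Set.mem_ofPred_eq, and_comm]

theorem gapSet_bddBelow : BddBelow (gapSet ω ω') := ⟨0, fun _ h => h.1.le⟩

theorem quantumIntertwiningGap_nonneg : 0 ≤ quantumIntertwiningGap ω ω' :=
  Real.sInf_nonneg fun _ h => h.1.le

theorem quantumIntertwiningGap_le {ε : ℝ} (h : ε ∈ gapSet ω ω') :
    quantumIntertwiningGap ω ω' ≤ ε :=
  csInf_le gapSet_bddBelow h

theorem mem_gapSet_of_gap_lt (hne : (gapSet ω ω').Nonempty) {ε : ℝ}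
    (h : quantumIntertwiningGap ω ω' < ε) : ε ∈ gapSet ω ω' := by
  obtain ⟨ε', ⟨h0, h1, h2⟩, hlt⟩ := exists_lt_of_csInf_lt hne h
  exact ⟨h0.trans hlt, h1.mono (almostIsometries_mono hlt.le),
    h2.mono (almostIsometries_mono hlt.le)⟩

theorem const_mem_almostIsometries (hω : IsMetricOn ω) (hω' : IsMetricOn ω')
    {C : ℝ} (hC : ∀ σ τ, ω σ τ < C) (hC' : ∀ σ τ, ω' σ τ < C) (σ₀ : TraceSpace A)
    (τ₀ : TraceSpace B) : (fun _ => τ₀) ∈ almostIsometries ω ω' C := by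
  refine ⟨continuous_const, isAffineMap_const_trace τ₀, fun σ τ => ?_, fun _ => σ₀,
    continuous_const, isAffineMap_const_trace σ₀, fun τ => hC' _ _⟩
  rw [hω'.self, zero_sub, abs_neg, abs_of_nonneg (hω.nonneg _ _)]
  exact hC σ τ

theorem gapSet_nonempty [CompactSpace (TraceSpace A)] [CompactSpace (TraceSpace B)]
    [Nonempty (TraceSpace A)] [Nonempty (TraceSpace B)] (hω : InducesTopology ω)
    (hω' : InducesTopology ω') : (gapSet ω ω').Nonempty := by
  obtain ⟨C, hC⟩ := hω.exists_bound
  obtain ⟨C', hC'⟩ := hω'.exists_bound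
  obtain ⟨σ₀⟩ := ‹Nonempty (TraceSpace A)›
  obtain ⟨τ₀⟩ := ‹Nonempty (TraceSpace B)›
  have h1 : ∀ σ τ, ω σ τ < max C C' + 1 := fun σ τ => by
    linarith [hC σ τ, le_max_left C C']
  have h2 : ∀ σ τ, ω' σ τ < max C C' + 1 := fun σ τ => by
    linarith [hC' σ τ, le_max_right C C']
  exact ⟨max C C' + 1, (hω.nonneg σ₀ σ₀).trans_lt (h1 σ₀ σ₀),
    ⟨_, const_mem_almostIsometries hω.toIsMetricOn hω'.toIsMetricOn h1 h2 σ₀ τ₀⟩,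
    ⟨_, const_mem_almostIsometries hω'.toIsMetricOn hω.toIsMetricOn h2 h1 τ₀ σ₀⟩⟩

theorem TraciallyIsomorphic.symm (h : TraciallyIsomorphic ω ω') : TraciallyIsomorphic ω' ω := by
  obtain ⟨f, hf, hd⟩ := h
  exact ⟨f.symm, trace_affine_symm f hf, fun σ τ => by simp [← hd]⟩

/-- The composite is `(ε₁ + ε₂)`-isometric, but its inversion error is `ε₁ + 2 * ε₂`: `f₂` distorts
the error of `f₁ ∘ g₁` by `ε₂` before its own inversion error is added. This is the origin of the
factor 2. -/
theorem almostIsometries_comp {A₃ : Type u} [CStarAlgebra A₃]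
    {ω₃ : TraceSpace A₃ → TraceSpace A₃ → ℝ} (h₃ : IsMetricOn ω₃) {ε₁ ε₂ : ℝ} (hε₁ : 0 < ε₁)
    (h1 : (almostIsometries ω ω' ε₁).Nonempty) (h2 : (almostIsometries ω' ω₃ ε₂).Nonempty) :
    (almostIsometries ω ω₃ (2 * (ε₁ + ε₂))).Nonempty := by
  obtain ⟨f₁, hf₁, af₁, if₁, g₁, hg₁, ag₁, ig₁⟩ := h1
  obtain ⟨f₂, hf₂, af₂, if₂, g₂, hg₂, ag₂, ig₂⟩ := h2
  refine ⟨fun σ => f₂ (f₁ σ), hf₂.comp hf₁, af₂.comp af₁, fun σ τ => ?_, fun τ => g₁ (g₂ τ),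
    hg₁.comp hg₂, ag₁.comp ag₂, fun τ => ?_⟩
  · have e1 := abs_lt.1 (if₁ σ τ)
    have e2 := abs_lt.1 (if₂ (f₁ σ) (f₁ τ))
    rw [abs_lt]
    constructor <;> linarith
  · have e1 := ig₁ (g₂ τ)
    have e2 := (abs_lt.1 (if₂ (f₁ (g₁ (g₂ τ))) (g₂ τ))).2
    have e3 := ig₂ τ
    have e4 := h₃.triangle (f₂ (f₁ (g₁ (g₂ τ)))) (f₂ (g₂ τ)) τ
    linarith

/-- Conjugation by the tracial isomorphisms. Their continuity is not part of the definition; it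
follows because the metrics induce the topologies. -/
theorem TraciallyIsomorphic.almostIsometries_nonempty {A' B' : Type u} [CStarAlgebra A']
    [CStarAlgebra B'] {ρ : TraceSpace A' → TraceSpace A' → ℝ}
    {ρ' : TraceSpace B' → TraceSpace B' → ℝ} (hω : InducesTopology ω) (hω' : InducesTopology ω')
    (hρ : InducesTopology ρ) (hρ' : InducesTopology ρ') (hA : TraciallyIsomorphic ω ρ)
    (hB : TraciallyIsomorphic ω' ρ') {ε : ℝ} (h : (almostIsometries ω ω' ε).Nonempty) :
    (almostIsometries ρ ρ' ε).Nonempty := by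
  obtain ⟨p, ap, ip⟩ := hA
  obtain ⟨q, aq, iq⟩ := hB
  obtain ⟨f, hf, af, if', g, hg, ag, ig⟩ := h
  have ip' : ∀ σ τ, ρ (p.symm σ) (p.symm τ) = ω σ τ := fun σ τ => by simp [← ip]
  have iq' : ∀ σ τ, ρ' (q.symm σ) (q.symm τ) = ω' σ τ := fun σ τ => by simp [← iq]
  refine ⟨fun σ => q.symm (f (p σ)),
    (hω'.continuous_of_isometry hρ' iq').comp (hf.comp (hρ.continuous_of_isometry hω ip)),
    (trace_affine_symm q aq).comp (af.comp ap), fun σ τ => ?_, fun τ => p.symm (g (q τ)),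
    (hω.continuous_of_isometry hρ ip').comp (hg.comp (hρ'.continuous_of_isometry hω' iq)),
    (trace_affine_symm p ap).comp (ag.comp aq), fun τ => ?_⟩
  · rw [iq', ← ip]
    exact if' _ _
  · rw [← iq]
    simpa using ig (q τ)

theorem TraciallyIsomorphic.gapSet_subset {A' B' : Type u} [CStarAlgebra A']
    [CStarAlgebra B'] {ρ : TraceSpace A' → TraceSpace A' → ℝ}
    {ρ' : TraceSpace B' → TraceSpace B' → ℝ} (hω : InducesTopology ω) (hω' : InducesTopology ω')
    (hρ : InducesTopology ρ) (hρ' : InducesTopology ρ') (hA : TraciallyIsomorphic ω ρ)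
    (hB : TraciallyIsomorphic ω' ρ') : gapSet ω ω' ⊆ gapSet ρ ρ' :=
  fun _ h => ⟨h.1, almostIsometries_nonempty hω hω' hρ hρ' hA hB h.2.1,
    almostIsometries_nonempty hω' hω hρ' hρ hB hA h.2.2⟩

theorem TraciallyIsomorphic.quantumIntertwiningGap_eq {A' B' : Type u} [CStarAlgebra A']
    [CStarAlgebra B'] {ρ : TraceSpace A' → TraceSpace A' → ℝ}
    {ρ' : TraceSpace B' → TraceSpace B' → ℝ} (hω : InducesTopology ω) (hω' : InducesTopology ω')
    (hρ : InducesTopology ρ) (hρ' : InducesTopology ρ') (hA : TraciallyIsomorphic ω ρ)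
    (hB : TraciallyIsomorphic ω' ρ') :
    quantumIntertwiningGap ω ω' = quantumIntertwiningGap ρ ρ' :=
  congrArg sInf ((gapSet_subset hω hω' hρ hρ' hA hB).antisymm
    (gapSet_subset hρ hρ' hω hω' hA.symm hB.symm))

/-- Compactness provides pointwise limits `F` and `G` of the maps and of their almost inverses along
one ultrafilter. Isometry and affinity are closed conditions and pass to `F`. -/
theorem traciallyIsomorphic_of_forall_almostIsometries [CompactSpace (TraceSpace A)]
    [CompactSpace (TraceSpace B)] (hω : InducesTopology ω) (hω' : InducesTopology ω')
    (h : ∀ ε > 0, (almostIsometries ω' ω ε).Nonempty) : TraciallyIsomorphic ω ω' := by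
  have := hω.t2Space
  choose f _ haf hif g _ _ hig using fun n : ℕ =>
    h (1 / ((n : ℝ) + 1)) Nat.one_div_pos_of_nat
  let U : Ultrafilter ℕ := hyperfilter ℕ
  have hU : (U : Filter ℕ) ≤ atTop := Nat.hyperfilter_le_atTop
  have h0 : Tendsto (fun n : ℕ => 1 / ((n : ℝ) + 1)) U (𝓝 0) :=
    tendsto_one_div_add_atTop_nhds_zero_nat.mono_left hU
  have hlim : ∀ {K : Type u} [TopologicalSpace K] [CompactSpace K] (u : ℕ → K),
      ∃ x, Tendsto u U (𝓝 x) := fun u => ⟨_, (U.map u).le_nhds_lim⟩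
  choose F hF using fun σ => hlim fun n => f n σ
  choose G hG using fun τ => hlim fun n => g n τ
  have hFiso : ∀ σ τ, ω (F σ) (F τ) = ω' σ τ := fun σ τ => by
    refine tendsto_nhds_unique ((hω.continuous.tendsto _).comp ((hF σ).prodMk_nhds (hF τ))) ?_
    rw [tendsto_iff_dist_tendsto_zero]
    exact squeeze_zero (fun _ => dist_nonneg) (fun n => (hif n σ τ).le) h0
  refine ⟨Equiv.ofBijective F ⟨fun σ τ hστ => ?_, fun τ => ⟨G τ, ?_⟩⟩, ?_, hFiso⟩
  · rw [← hω'.eq_zero_iff, ← hFiso, hστ, hω.self]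
  -- Both `F (G τ)` and `τ` are limits of `f n (g n τ)`: the former since the `f n` are uniformly
  -- almost isometric and `g n τ` tends to `G τ`, the latter by almost invertibility.
  · refine tendsto_nhds_unique (f := fun n => f n (g n τ)) (l := (U : Filter ℕ)) ?_ ?_
    · rw [hω.tendsto_iff]
      have h1 := ((hω'.tendsto_iff.1 (hG τ)).add h0).add (hω.tendsto_iff.1 (hF (G τ)))
      rw [add_zero, add_zero] at h1
      refine squeeze_zero (fun _ => hω.nonneg _ _) (fun n => ?_) h1
      have e1 := hω.triangle (f n (g n τ)) (f n (G τ)) (F (G τ))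
      have e2 := (abs_lt.1 (hif n (g n τ) (G τ))).2
      linarith
    · rw [hω.tendsto_iff]
      exact squeeze_zero (fun _ => hω.nonneg _ _) (fun n => (hig n τ).le) h0
  · exact fun n w hw σ s hs => TraceSpace.isCombination_of_tendsto
      (fun k => haf k n w hw σ s hs) (fun j => hF (σ j)) (hF s)

theorem mem_gapSet_of_almostIsometricProb {Ω : QuasiWassersteinMetric.{u}} {X Y : Type u}
    [MetricSpace X] [CompactSpace X] [Nonempty X] [MeasurableSpace X] [BorelSpace X]
    [MetricSpace Y] [CompactSpace Y] [Nonempty Y] [MeasurableSpace Y] [BorelSpace Y]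
    (hX : Observes Ω A ω X) (hY : Observes Ω B ω' Y) {ε : ℝ} (hε : 0 < ε)
    (h : AlmostIsometricProb Ω X Y ε) : ε ∈ gapSet ω ω' := by
  obtain ⟨p, ap, ip⟩ := hX
  obtain ⟨q, aq, iq⟩ := hY
  obtain ⟨f, g, hf, af, hg, ag, if', ig, hfg, hgf⟩ := h
  have ap' : IsAffineMap p.symm := IsAffineMap.symm_of_trace (e := p.toEquiv) ap
  have aq' : IsAffineMap q.symm := IsAffineMap.symm_of_trace (e := q.toEquiv) aq
  have ip' : ∀ σ τ, ω σ τ = Ω.distance X (p.symm σ) (p.symm τ) := fun σ τ => by simp [← ip]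
  have iq' : ∀ σ τ, ω' σ τ = Ω.distance Y (q.symm σ) (q.symm τ) := fun σ τ => by simp [← iq]
  refine ⟨hε, ⟨fun σ => q (f (p.symm σ)), ?_, ?_, fun σ τ => ?_, fun τ => p (g (q.symm τ)),
      ?_, ?_, fun τ => ?_⟩,
    ⟨fun τ => p (g (q.symm τ)), ?_, ?_, fun σ τ => ?_, fun σ => q (f (p.symm σ)),
      ?_, ?_, fun τ => ?_⟩⟩
  · exact q.continuous.comp (hf.comp p.symm.continuous)
  · exact aq.comp (af.comp ap')
  · rw [iq, ip']
    exact if' _ _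
  · exact p.continuous.comp (hg.comp q.symm.continuous)
  · exact ap.comp (ag.comp aq')
  · rw [iq']
    simpa using hfg (q.symm τ)
  · exact p.continuous.comp (hg.comp q.symm.continuous)
  · exact ap.comp (ag.comp aq')
  · rw [ip, iq']
    exact ig _ _
  · exact q.continuous.comp (hf.comp p.symm.continuous)
  · exact aq.comp (af.comp ap')
  · rw [ip']
    simpa using hgf (p.symm τ)

end Trace

/-! ### The trace space of `C(X, ℂ)` -/

section ContinuousFunctions

variable {X : Type u} [MetricSpace X] [CompactSpace X] [MeasurableSpace X] [BorelSpace X]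

/-- Integration against a probability measure, as a tracial state on `C(X, ℂ)`. -/
noncomputable def probTrace (μ : ProbabilityMeasure X) : TraceSpace C(X, ℂ) :=
  ⟨StrongDual.toWeakDual (LinearMap.mkContinuous
    { toFun := fun f : C(X, ℂ) => ∫ z, f z ∂(μ : Measure X)
      map_add' := fun f g =>
        integral_add (integrable_continuousMap f _) (integrable_continuousMap g _)
      map_smul' := fun c f => integral_const_mul c f } 1 fun f => by
        simpa using norm_integral_le_of_norm_le_const (μ := (μ : Measure X))
          (ae_of_all _ f.norm_coe_le_norm)), by
    refine ⟨fun f => ?_, ?_, fun f v hv => ?_⟩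
    · change 0 ≤ ∫ z, star (f z) * f z ∂(μ : Measure X)
      exact integral_nonneg fun z => star_mul_self_nonneg (f z)
    · change ∫ z, (1 : ℂ) ∂(μ : Measure X) = 1
      simp
    · have : v * f * star v = f := by
        rw [mul_comm, ← mul_assoc, (Unitary.mem_iff.1 hv).1, one_mul]
      rw [this]⟩

theorem probTrace_apply (μ : ProbabilityMeasure X) (f : C(X, ℂ)) :
    (probTrace μ).1 f = ∫ z, f z ∂(μ : Measure X) := rfl

theorem continuous_probTrace : Continuous (probTrace : ProbabilityMeasure X → _) := by
  refine Continuous.subtype_mk (WeakDual.continuous_of_continuous_eval fun f => ?_) _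
  change Continuous fun μ : ProbabilityMeasure X => ∫ z, f z ∂(μ : Measure X)
  rw [continuous_iff_continuousAt]
  exact fun μ => (ProbabilityMeasure.tendsto_iff_forall_integral_rclike_tendsto ℂ).1 tendsto_id
    (BoundedContinuousFunction.mkOfCompact f)

theorem isAffineMap_probTrace : IsAffineMap (probTrace : ProbabilityMeasure X → _) := by
  intro n w hw σ s hs f
  rw [eq_mixture_of_isCombination hw hs]
  simp only [probTrace_apply]
  rw [integral_mixture hw _ fun i => integrable_continuousMap f _]
  simp

/-- A real-valued continuous function as a complex-valued one. -/
def ContinuousMap.toComplex {X : Type*} [TopologicalSpace X] (g : C(X, ℝ)) : C(X, ℂ) :=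
  ⟨fun z => (g z : ℂ), by fun_prop⟩

theorem probTrace_toComplex (μ : ProbabilityMeasure X) (g : C(X, ℝ)) :
    (probTrace μ).1 g.toComplex = ((∫ z, g z ∂(μ : Measure X) : ℝ) : ℂ) :=
  integral_ofReal

theorem probTrace_injective : Function.Injective (probTrace : ProbabilityMeasure X → _) := by
  intro μ ν h
  refine ext_of_integral_continuousMap fun g => ?_
  have := congrArg (fun σ : TraceSpace C(X, ℂ) => σ.1 g.toComplex) h
  simp only [probTrace_toComplex] at this
  exact_mod_cast this

omit [MeasurableSpace X] [BorelSpace X] in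
-- A nonnegative function has the form `star a * a` with `a` its square root.
theorem TraceSpace.nonneg_toComplex (τ : TraceSpace C(X, ℂ)) {g : C(X, ℝ)} (hg : ∀ z, 0 ≤ g z) :
    0 ≤ τ.1 g.toComplex := by
  let a : C(X, ℝ) := ⟨fun z => √(g z), by fun_prop⟩
  have : g.toComplex = star a.toComplex * a.toComplex := by
    ext z
    change (g z : ℂ) = star ((√(g z) : ℝ) : ℂ) * ((√(g z) : ℝ) : ℂ)
    rw [Complex.star_def, Complex.conj_ofReal, ← Complex.ofReal_mul, Real.mul_self_sqrt (hg z)]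
  rw [this]
  exact τ.2.pos _

omit [MeasurableSpace X] [BorelSpace X] in
theorem TraceSpace.toComplex_im (τ : TraceSpace C(X, ℂ)) (g : C(X, ℝ)) :
    (τ.1 g.toComplex).im = 0 := by
  -- Adding the constant `‖g‖` makes the function nonnegative, and nonnegative complex numbers are
  -- real.
  let g' : C(X, ℝ) := ⟨fun z => g z + ‖g‖, by fun_prop⟩
  have h0 : 0 ≤ τ.1 g'.toComplex := τ.nonneg_toComplex fun z => by
    have := (abs_le.1 (g.norm_coe_le_norm z)).1
    change 0 ≤ g z + ‖g‖
    linarith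
  have h1 : g.toComplex = g'.toComplex - (‖g‖ : ℂ) • (1 : C(X, ℂ)) := by
    ext z
    change (g z : ℂ) = ((g z + ‖g‖ : ℝ) : ℂ) - (‖g‖ : ℂ) * 1
    push_cast
    ring
  rw [h1, map_sub, map_smul, τ.2.map_one]
  simp [← (Complex.nonneg_iff.1 h0).2]

/-- The Riesz-Markov-Kakutani theorem, applied to the restriction of the trace to real-valued
functions. -/
theorem probTrace_surjective : Function.Surjective (probTrace : ProbabilityMeasure X → _) := by
  intro τ
  let Λ : CompactlySupportedContinuousMap X ℝ →ₚ[ℝ] ℝ :=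
    { toFun := fun g => (τ.1 (ContinuousMap.toComplex g.toContinuousMap)).re
      map_add' := fun g g' => by
        have : ContinuousMap.toComplex (g + g').toContinuousMap
            = ContinuousMap.toComplex g.toContinuousMap
              + ContinuousMap.toComplex g'.toContinuousMap := by
          ext z
          exact Complex.ofReal_add _ _
        rw [this, map_add, Complex.add_re]
      map_smul' := fun c g => by
        have : ContinuousMap.toComplex (c • g).toContinuousMap
            = (c : ℂ) • ContinuousMap.toComplex g.toContinuousMap := by
          ext z
          exact Complex.ofReal_mul _ _
        rw [this, map_smul]
        simp
      monotone' := fun g g' h => by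
        have h0 := τ.nonneg_toComplex (g := g'.toContinuousMap - g.toContinuousMap)
          fun z => sub_nonneg.2 (h z)
        have : ContinuousMap.toComplex (g'.toContinuousMap - g.toContinuousMap)
            = ContinuousMap.toComplex g'.toContinuousMap
              - ContinuousMap.toComplex g.toContinuousMap := by
          ext z
          exact Complex.ofReal_sub _ _
        rw [this, map_sub] at h0
        have := (Complex.nonneg_iff.1 h0).1
        rw [Complex.sub_re] at this
        exact sub_nonneg.1 this }
  let m : Measure X := RealRMK.rieszMeasure Λ
  have hm : ∀ g : C(X, ℝ), ∫ z, g z ∂m = (τ.1 g.toComplex).re := fun g =>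
    RealRMK.integral_rieszMeasure Λ ⟨g, HasCompactSupport.of_compactSpace _⟩
  have hfin : IsFiniteMeasure m := inferInstanceAs (IsFiniteMeasure (RealRMK.rieszMeasure Λ))
  have h1 : IsProbabilityMeasure m := by
    have h := hm 1
    have e : ContinuousMap.toComplex (1 : C(X, ℝ)) = 1 := by
      ext z
      exact Complex.ofReal_one
    rw [e, τ.2.map_one] at h
    simp only [ContinuousMap.one_apply, integral_const, smul_eq_mul, mul_one, Complex.one_re] at h
    constructor
    rw [← ENNReal.ofReal_toReal (measure_ne_top m Set.univ)]
    change ENNReal.ofReal (m.real Set.univ) = 1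
    rw [h, ENNReal.ofReal_one]
  let m' : ProbabilityMeasure X := ⟨m, h1⟩
  have hre : ∀ g : C(X, ℝ), (probTrace m').1 g.toComplex = τ.1 g.toComplex := fun g => by
    rw [probTrace_toComplex]
    refine Complex.ext ?_ ?_
    · rw [Complex.ofReal_re]
      exact hm g
    · rw [Complex.ofReal_im, τ.toComplex_im]
  refine ⟨m', Subtype.ext (DFunLike.ext _ _ fun f => ?_)⟩
  let a : C(X, ℝ) := ⟨fun z => (f z).re, by fun_prop⟩
  let b : C(X, ℝ) := ⟨fun z => (f z).im, by fun_prop⟩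
  have hf : f = a.toComplex + Complex.I • b.toComplex := by
    ext z
    change f z = ((f z).re : ℂ) + Complex.I * ((f z).im : ℂ)
    rw [mul_comm, Complex.re_add_im]
  rw [hf, map_add, map_add, map_smul, map_smul, hre, hre]

/-- The trace space of `C(X, ℂ)` is `Prob(X)`. -/
noncomputable def probTraceHomeomorph : ProbabilityMeasure X ≃ₜ TraceSpace C(X, ℂ) :=
  continuous_probTrace.homeoOfEquivCompactToT2
    (f := Equiv.ofBijective probTrace ⟨probTrace_injective, probTrace_surjective⟩)

theorem isAffineMap_probTraceHomeomorph :
    IsAffineMap (probTraceHomeomorph : ProbabilityMeasure X ≃ₜ TraceSpace C(X, ℂ)) :=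
  isAffineMap_probTrace

/-! ### Lipschitz functions and the Wasserstein metric -/

-- Stone-Weierstrass: Lipschitz functions form a star-subalgebra, and distances to points separate
-- points.
omit [MeasurableSpace X] [BorelSpace X] in
theorem dense_setOf_lipschitz :
    Dense {f : C(X, ℂ) | ∃ C : ℝ, ∀ x y, ‖f x - f y‖ ≤ C * dist x y} := by
  let L : StarSubalgebra ℂ C(X, ℂ) :=
    { carrier := {f | ∃ C : ℝ, ∀ x y, ‖f x - f y‖ ≤ C * dist x y}
      mul_mem' := by
        rintro f g ⟨C, hC⟩ ⟨D, hD⟩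
        refine ⟨‖f‖ * D + C * ‖g‖, fun x y => ?_⟩
        have e : (f * g) x - (f * g) y = f x * (g x - g y) + (f x - f y) * g y := by
          simp only [ContinuousMap.mul_apply]
          ring
        rw [e, add_mul]
        refine (norm_add_le _ _).trans (add_le_add ?_ ?_)
        · rw [norm_mul, mul_assoc]
          exact mul_le_mul (f.norm_coe_le_norm x) (hD x y) (norm_nonneg _) (norm_nonneg _)
        · rw [norm_mul, mul_right_comm]
          exact mul_le_mul (hC x y) (g.norm_coe_le_norm y) (norm_nonneg _)
            ((norm_nonneg _).trans (hC x y))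
      add_mem' := by
        rintro f g ⟨C, hC⟩ ⟨D, hD⟩
        refine ⟨C + D, fun x y => ?_⟩
        have e : (f + g) x - (f + g) y = (f x - f y) + (g x - g y) := by
          simp only [ContinuousMap.add_apply]
          ring
        rw [e, add_mul]
        exact (norm_add_le _ _).trans (add_le_add (hC x y) (hD x y))
      algebraMap_mem' := fun c => ⟨0, fun x y => by simp⟩
      star_mem' := by
        rintro f ⟨C, hC⟩
        refine ⟨C, fun x y => ?_⟩
        rw [ContinuousMap.star_apply, ContinuousMap.star_apply, ← star_sub, norm_star]
        exact hC x y }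
  have hL : L.SeparatesPoints := by
    intro x y hxy
    refine ⟨_, ⟨⟨fun z => ((dist z x : ℝ) : ℂ), by fun_prop⟩, ⟨1, fun a b => ?_⟩, rfl⟩, ?_⟩
    · simp only [ContinuousMap.coe_mk]
      rw [← Complex.ofReal_sub, Complex.norm_real, Real.norm_eq_abs, one_mul]
      exact abs_dist_sub_le _ _ _
    · simpa [eq_comm] using hxy
  have := ContinuousMap.starSubalgebra_topologicalClosure_eq_top_of_separatesPoints L hL
  intro f
  have hf : f ∈ L.topologicalClosure := by
    rw [this]
    trivial
  exact hf

/-- The easy half of Kantorovich duality. -/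
theorem norm_integral_sub_le_wassersteinOne {f : C(X, ℂ)} {C : ℝ} (hC : 0 < C)
    (hf : ∀ x y, ‖f x - f y‖ ≤ C * dist x y) (μ ν : ProbabilityMeasure X) :
    ‖∫ z, f z ∂(μ : Measure X) - ∫ z, f z ∂(ν : Measure X)‖ ≤ C * wassersteinOne μ ν := by
  rw [← div_le_iff₀' hC]
  -- The product coupling shows that the infimum is over a nonempty set.
  refine le_csInf ⟨_, ⟨(μ : Measure X).prod (ν : Measure X), inferInstance⟩, ?_, ?_, rfl⟩ ?_
  · exact Measure.map_fst_prod.trans (by simp)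
  · exact Measure.map_snd_prod.trans (by simp)
  · rintro c ⟨π, h1, h2, rfl⟩
    rw [div_le_iff₀' hC, ← h1, ← h2, integral_map measurable_fst.aemeasurable
      f.continuous.aestronglyMeasurable, integral_map measurable_snd.aemeasurable
      f.continuous.aestronglyMeasurable, ← integral_sub, ← integral_const_mul]
    · refine norm_integral_le_of_norm_le ?_ (ae_of_all _ fun z => hf z.1 z.2)
      exact (integrable_continuousMap
        (⟨fun z => dist z.1 z.2, by fun_prop⟩ : C(X × X, ℝ)) _).const_mul C
    · exact integrable_continuousMap (f.comp ⟨Prod.fst, continuous_fst⟩) _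
    · exact integrable_continuousMap (f.comp ⟨Prod.snd, continuous_snd⟩) _

variable [Nonempty X] (Ω : QuasiWassersteinMetric.{u})

/-- The metric on `T(C(X, ℂ))` that corresponds to `Ω_X`. -/
noncomputable def traceDistance (σ τ : TraceSpace C(X, ℂ)) : ℝ :=
  Ω.distance X (probTraceHomeomorph.symm σ) (probTraceHomeomorph.symm τ)

theorem observes_continuousMap : Observes Ω C(X, ℂ) (traceDistance Ω) X :=
  ⟨probTraceHomeomorph, isAffineMap_probTraceHomeomorph, fun μ ν => by simp [traceDistance]⟩

theorem isTraciallyLyriform_continuousMap (hX : Metric.ediam (Set.univ : Set X) ≤ Ω.D) :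
    IsTraciallyLyriform C(X, ℂ) (traceDistance (X := X) Ω) := by
  have hΩ : InducesTopology (traceDistance (X := X) Ω) :=
    (Ω.inducesTopology hX).of_homeomorph probTraceHomeomorph fun μ ν => by simp [traceDistance]
  have hcomp : CompactSpace (TraceSpace C(X, ℂ)) := probTraceHomeomorph.compactSpace
  refine ⟨inferInstance, hΩ.toIsMetricOn, hΩ.exists_bound, hΩ.continuous.lowerSemicontinuous,
    ?_, ?_⟩
  · obtain ⟨h, hh, hq⟩ := Ω.quasiconvex (Metric.diam (Set.univ : Set X) + 1) (by positivity)
    refine ⟨h, hh, fun n w hw σ τ s t hs ht => ?_⟩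
    have haff : IsAffineMap (probTraceHomeomorph (X := X)).symm :=
      IsAffineMap.symm_of_trace (e := (probTraceHomeomorph (X := X)).toEquiv)
        isAffineMap_probTraceHomeomorph
    refine hq X hX ?_ n w hw _ _ _ _ (haff n w hw _ _ hs) (haff n w hw _ _ ht)
    refine Metric.ediam_le fun a _ b _ => ?_
    rw [edist_dist]
    refine ENNReal.ofReal_le_ofReal ?_
    have := Metric.dist_le_diam_of_mem (isCompact_univ (X := X)).isBounded (Set.mem_univ a)
      (Set.mem_univ b)
    linarith
  -- By the lower Wasserstein bound, every Lipschitz function on `X` has finite tracial Lipschitz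
  -- seminorm.
  · obtain ⟨K, hK, hW⟩ := Ω.wasserstein_le
    refine dense_setOf_lipschitz.mono ?_
    rintro f ⟨C, hC⟩
    have hC' : ∀ x y, ‖f x - f y‖ ≤ (|C| + 1) * dist x y := fun x y =>
      (hC x y).trans (mul_le_mul_of_nonneg_right (by linarith [le_abs_self C]) dist_nonneg)
    refine lt_of_le_of_lt (iSup_le fun σ => iSup_le fun τ => iSup_le fun hστ => ?_)
      (ENNReal.ofReal_lt_top (r := (|C| + 1) * K))
    refine ENNReal.ofReal_le_ofReal ?_
    refine div_le_of_le_mul₀ (hΩ.nonneg _ _) (by positivity) ?_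
    have e : ∀ σ : TraceSpace C(X, ℂ), σ.1 f
        = ∫ z, f z ∂(probTraceHomeomorph.symm σ : ProbabilityMeasure X) := fun σ => by
      conv_lhs => rw [← probTraceHomeomorph.apply_symm_apply σ]
      rfl
    rw [e, e, mul_assoc]
    exact (norm_integral_sub_le_wassersteinOne (by positivity) hC' _ _).trans
      (mul_le_mul_of_nonneg_left (hW X hX _ _) (by positivity))

/-- `C(X, ℂ)` as an `Ω`-quasi-Wasserstein space. -/
noncomputable def continuousMapSpace (X : Type u) [MetricSpace X] [CompactSpace X]
    [MeasurableSpace X] [BorelSpace X] [Nonempty X]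
    (hX : Metric.ediam (Set.univ : Set X) ≤ Ω.D) : QuasiWassersteinSpace Ω where
  A := C(X, ℂ)
  ω := traceDistance Ω
  lyriform := isTraciallyLyriform_continuousMap Ω hX
  observes := ⟨X, _, _, _, _, _, hX, observes_continuousMap Ω⟩

end ContinuousFunctions

/-! ### Quasi-Wasserstein spaces and their classes -/

namespace QuasiWassersteinSpace

variable {Ω : QuasiWassersteinMetric.{u}} (S T U : QuasiWassersteinSpace Ω)

/-- A compact metric space observed by `S`. -/
def Observed : Type u := S.observes.choose

noncomputable instance : MetricSpace S.Observed := S.observes.choose_spec.choose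

instance : CompactSpace S.Observed := S.observes.choose_spec.choose_spec.choose

instance : Nonempty S.Observed := S.observes.choose_spec.choose_spec.choose_spec.choose

noncomputable instance : MeasurableSpace S.Observed :=
  S.observes.choose_spec.choose_spec.choose_spec.choose_spec.choose

instance : BorelSpace S.Observed :=
  S.observes.choose_spec.choose_spec.choose_spec.choose_spec.choose_spec.choose

theorem ediam_observed : Metric.ediam (Set.univ : Set S.Observed) ≤ Ω.D :=
  S.observes.choose_spec.choose_spec.choose_spec.choose_spec.choose_spec.choose_spec.1

theorem observes_observed : Observes Ω S.A S.ω S.Observed :=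
  S.observes.choose_spec.choose_spec.choose_spec.choose_spec.choose_spec.choose_spec.2

theorem inducesTopology : InducesTopology S.ω := by
  obtain ⟨e, -, he⟩ := S.observes_observed
  exact (Ω.inducesTopology S.ediam_observed).of_homeomorph e he

instance : CompactSpace (TraceSpace S.A) := S.observes_observed.choose.compactSpace

instance : Nonempty (TraceSpace S.A) := by
  obtain ⟨e, -⟩ := S.observes_observed
  obtain ⟨x⟩ := (inferInstance : Nonempty S.Observed)
  exact ⟨e (diracProb x)⟩

theorem gapSet_nonempty : (gapSet S.ω T.ω).Nonempty :=
  _root_.gapSet_nonempty S.inducesTopology T.inducesTopology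

theorem gap_self : quantumIntertwiningGap S.ω S.ω = 0 := by
  refine le_antisymm (le_of_forall_pos_le_add fun ε hε => ?_) quantumIntertwiningGap_nonneg
  rw [zero_add]
  have : (almostIsometries S.ω S.ω ε).Nonempty :=
    ⟨fun σ => σ, continuous_id, IsAffineMap.id, fun σ τ => by simpa using hε, fun σ => σ,
      continuous_id, IsAffineMap.id, fun τ => by rwa [S.inducesTopology.self]⟩
  exact quantumIntertwiningGap_le ⟨hε, this, this⟩

theorem gap_triangle : quantumIntertwiningGap S.ω U.ω
    ≤ 2 * (quantumIntertwiningGap S.ω T.ω + quantumIntertwiningGap T.ω U.ω) := by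
  refine le_of_forall_pos_le_add fun ε hε => ?_
  obtain ⟨h1, h2, h3⟩ := mem_gapSet_of_gap_lt (S.gapSet_nonempty T)
    (lt_add_of_pos_right _ (show 0 < ε / 4 by positivity))
  obtain ⟨k1, k2, k3⟩ := mem_gapSet_of_gap_lt (T.gapSet_nonempty U)
    (lt_add_of_pos_right _ (show 0 < ε / 4 by positivity))
  refine (quantumIntertwiningGap_le ⟨?_,
    almostIsometries_comp U.inducesTopology.toIsMetricOn h1 h2 k2, ?_⟩).trans_eq
      (by ring : _ = 2 * (quantumIntertwiningGap S.ω T.ω + quantumIntertwiningGap T.ω U.ω) + ε)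
  · positivity
  · rw [add_comm (_ + ε / 4)]
    exact almostIsometries_comp S.inducesTopology.toIsMetricOn k1 k3 h3

theorem traciallyIsomorphic_of_gap_eq_zero (h : quantumIntertwiningGap S.ω T.ω = 0) :
    TraciallyIsomorphic S.ω T.ω :=
  traciallyIsomorphic_of_forall_almostIsometries S.inducesTopology T.inducesTopology fun _ hε =>
    (mem_gapSet_of_gap_lt (S.gapSet_nonempty T) (h.trans_lt hε)).2.2

theorem exists_pos_forall_gap_lt {ε : ℝ} (hε : 0 < ε) {X : Type u} [MetricSpace X]
    [CompactSpace X] [Nonempty X] [MeasurableSpace X] [BorelSpace X]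
    (hX : Metric.ediam (Set.univ : Set X) ≤ Ω.D) (hS : Observes Ω S.A S.ω X) :
    ∃ η > 0, ∀ T : QuasiWassersteinSpace Ω, GromovHausdorff.ghDist X T.Observed < η →
      quantumIntertwiningGap S.ω T.ω < ε := by
  obtain ⟨η, hη, h⟩ := Ω.exists_almostIsometricProb X hX (half_pos hε)
  exact ⟨η, hη, fun T hT => (quantumIntertwiningGap_le (mem_gapSet_of_almostIsometricProb hS
    T.observes_observed (half_pos hε) (h _ T.ediam_observed hT))).trans_lt (half_lt_self hε)⟩

variable {S T} in
-- Restricting an almost isometry to Dirac measures embeds the observed space almost isometrically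
-- into a trace space. The image need not consist of Dirac measures, but bounds on diameter and
-- covering numbers survive.
theorem exists_map_observed {ε : ℝ} (h : (almostIsometries S.ω T.ω ε).Nonempty) :
    ∃ i : S.Observed → TraceSpace T.A, ∀ x y, |T.ω (i x) (i y) - dist x y| < ε := by
  obtain ⟨f, -, -, hf, -⟩ := h
  obtain ⟨e, -, he⟩ := S.observes_observed
  refine ⟨fun x => f (e (diracProb x)), fun x y => ?_⟩
  rw [← Ω.dirac S.Observed S.ediam_observed, ← he]
  exact hf _ _

variable {S T} in
theorem exists_finset_observed {ε : ℝ} (h : (almostIsometries S.ω T.ω ε).Nonempty)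
    {t : Finset (TraceSpace T.A)} (ht : ∀ τ, ∃ z ∈ t, T.ω τ z < ε) :
    ∃ s : Finset S.Observed, s.card ≤ t.card ∧ ∀ x, ∃ y ∈ s, dist x y < 3 * ε := by
  classical
  obtain ⟨i, hi⟩ := exists_map_observed h
  -- Net points in the trace space need not lie in the image of `i`; each is replaced by some
  -- observed point mapped near it, if there is one. Two steps of `ε` and the distortion of `i` give
  -- `3 * ε`.
  have hc : ∀ z, ∃ y, ∀ x, T.ω (i x) z < ε → T.ω (i y) z < ε := fun z => by
    by_cases hz : ∃ y, T.ω (i y) z < ε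
    · exact hz.imp fun y hy _ _ => hy
    · exact ⟨Classical.arbitrary _, fun x hx => (hz ⟨x, hx⟩).elim⟩
  choose c hc using hc
  refine ⟨t.image c, Finset.card_image_le, fun x => ?_⟩
  obtain ⟨z, hz, hxz⟩ := ht (i x)
  refine ⟨c z, Finset.mem_image_of_mem c hz, ?_⟩
  have e1 := hc z x hxz
  have e2 := (abs_lt.1 (hi x (c z))).1
  have e3 := T.inducesTopology.triangle (i x) z (i (c z))
  rw [T.inducesTopology.symm z] at e3
  linarith

end QuasiWassersteinSpace

/-! ### Gromov precompactness along Cauchy sequences -/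

section Precompact

open QuasiWassersteinSpace

variable {Ω : QuasiWassersteinMetric.{u}} {S : ℕ → QuasiWassersteinSpace Ω}

/-- A bound that holds eventually and can be satisfied for each index holds uniformly. -/
theorem exists_uniform_bound {P : ℕ → ℝ → Prop} (hP : ∀ n a b, a ≤ b → P n a → P n b)
    (h : ∀ n, ∃ a, P n a) {N : ℕ} {a : ℝ} (ha : ∀ n ≥ N, P n a) : ∃ b, ∀ n, P n b := by
  choose f hf using h
  obtain ⟨b, hb⟩ := ((Finset.range N).image f ∪ {a}).bddAbove
  refine ⟨b, fun n => ?_⟩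
  rcases lt_or_ge n N with hn | hn
  · exact hP n _ _ (hb (Finset.mem_coe.2 <| Finset.mem_union_left _ <|
      Finset.mem_image_of_mem f (Finset.mem_range.2 hn))) (hf n)
  · exact hP n _ _ (hb (by simp)) (ha n hn)

/-- All late terms are compared with the one trace space of `S N`, whose finite net bounds their
covering numbers; finitely many earlier terms remain. -/
theorem exists_uniform_finset
    (hS : ∀ ε > 0, ∃ N, ∀ m ≥ N, ∀ n ≥ N, quantumIntertwiningGap (S m).ω (S n).ω < ε) {ε : ℝ}
    (hε : 0 < ε) : ∃ K : ℕ, ∀ n, ∃ s : Finset (S n).Observed, s.card ≤ K ∧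
      ∀ x, ∃ y ∈ s, dist x y < ε := by
  obtain ⟨N, hN⟩ := hS (ε / 3) (by positivity)
  obtain ⟨t, ht⟩ := (S N).inducesTopology.exists_finite_net (ε := ε / 3) (by positivity)
  have key : ∃ b : ℝ, ∀ n, ∃ s : Finset (S n).Observed, (s.card : ℝ) ≤ b ∧
      ∀ x, ∃ y ∈ s, dist x y < ε := by
    refine exists_uniform_bound
      (P := fun n b => ∃ s : Finset (S n).Observed, (s.card : ℝ) ≤ b ∧ ∀ x, ∃ y ∈ s, dist x y < ε)
      (fun n a b hab h => h.imp fun s hs => ⟨hs.1.trans hab, hs.2⟩) (fun n => ?_) (N := N)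
      (a := t.card) fun n hn => ?_
    · obtain ⟨t, -, ht, hcov⟩ :=
        finite_cover_balls_of_compact (isCompact_univ (X := (S n).Observed)) hε
      refine ⟨_, ht.toFinset, le_rfl, fun x => ?_⟩
      obtain ⟨z, hz, hx⟩ := Set.mem_iUnion₂.1 (hcov (Set.mem_univ x))
      exact ⟨z, ht.mem_toFinset.2 hz, hx⟩
    · obtain ⟨s, h1, h2⟩ := exists_finset_observed
        (mem_gapSet_of_gap_lt ((S n).gapSet_nonempty (S N)) (hN n hn N le_rfl)).2.1 ht
      exact ⟨s, by exact_mod_cast h1, fun x => by simpa [mul_div_cancel₀] using h2 x⟩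
  obtain ⟨b, hb⟩ := key
  refine ⟨⌊b⌋₊, fun n => ?_⟩
  obtain ⟨s, h1, h2⟩ := hb n
  exact ⟨s, Nat.le_floor h1, h2⟩

theorem exists_uniform_dist_le
    (hS : ∀ ε > 0, ∃ N, ∀ m ≥ N, ∀ n ≥ N, quantumIntertwiningGap (S m).ω (S n).ω < ε) :
    ∃ C, ∀ n, ∀ x y : (S n).Observed, dist x y ≤ C := by
  obtain ⟨N, hN⟩ := hS 1 one_pos
  obtain ⟨C, hC⟩ := (S N).inducesTopology.exists_bound
  refine exists_uniform_bound (P := fun n b => ∀ x y : (S n).Observed, dist x y ≤ b)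
    (fun n a b hab h x y => (h x y).trans hab) (fun n => ?_) (N := N) (a := C + 1) fun n hn => ?_
  · exact ⟨Metric.diam Set.univ, fun x y => Metric.dist_le_diam_of_mem isCompact_univ.isBounded
      (Set.mem_univ x) (Set.mem_univ y)⟩
  · obtain ⟨i, hi⟩ := exists_map_observed
      (mem_gapSet_of_gap_lt ((S n).gapSet_nonempty (S N)) (hN n hn N le_rfl)).2.1
    exact fun x y => by linarith [(abs_lt.1 (hi x y)).1, hC (i x) (i y)]

theorem totallyBounded_range_observed
    (hS : ∀ ε > 0, ∃ N, ∀ m ≥ N, ∀ n ≥ N, quantumIntertwiningGap (S m).ω (S n).ω < ε) :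
    TotallyBounded (Set.range fun n => GromovHausdorff.toGHSpace (S n).Observed) := by
  obtain ⟨C, hC⟩ := exists_uniform_dist_le hS
  have hC0 : 0 ≤ C := by
    obtain ⟨x⟩ := (inferInstance : Nonempty (S 0).Observed)
    exact dist_nonneg.trans (hC 0 x x)
  choose K hK using fun k : ℕ =>
    exists_uniform_finset hS (Nat.one_div_pos_of_nat (n := k) (α := ℝ))
  have hiso : ∀ n, Nonempty
      ((S n).Observed ≃ᵢ (GromovHausdorff.toGHSpace (S n).Observed).Rep) := fun n => by
    rw [← GromovHausdorff.toGHSpace_eq_toGHSpace_iff_isometryEquiv,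
      GromovHausdorff.GHSpace.toGHSpace_rep]
  refine GromovHausdorff.totallyBounded (C := C) (K := K)
    tendsto_one_div_add_atTop_nhds_zero_nat ?_ ?_
  · rintro _ ⟨n, rfl⟩
    obtain ⟨e⟩ := hiso n
    refine Metric.diam_le_of_forall_dist_le hC0 fun a _ b _ => ?_
    rw [← e.symm.isometry.dist_eq]
    exact hC n _ _
  · rintro _ ⟨n, rfl⟩ k
    obtain ⟨e⟩ := hiso n
    obtain ⟨s, hs, hcov⟩ := hK k n
    classical
    refine ⟨(s.image e : Finset _), ?_, fun a _ => ?_⟩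
    · exact (Cardinal.mk_coe_finset (s := s.image e)).trans_le
        (Nat.cast_le.2 (Finset.card_image_le.trans hs))
    · obtain ⟨y, hy, hay⟩ := hcov (e.symm a)
      refine Set.mem_iUnion₂.2 ⟨e y, Finset.mem_coe.2 (Finset.mem_image_of_mem e hy), ?_⟩
      rw [Metric.mem_ball, ← e.symm.isometry.dist_eq, e.symm_apply_apply]
      exact hay

/-- Ensures that the limit space is still in the domain of `Ω`. -/
theorem ediam_le_of_tendsto_ghDist {X : Type u} [MetricSpace X] [CompactSpace X] [Nonempty X]
    (h : ∀ η > 0, ∃ T : QuasiWassersteinSpace Ω, GromovHausdorff.ghDist X T.Observed < η) :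
    Metric.ediam (Set.univ : Set X) ≤ Ω.D := by
  refine Metric.ediam_le fun a _ b _ => ENNReal.le_of_forall_pos_le_add fun ε hε _ => ?_
  obtain ⟨T, hT⟩ := h (ε / 2) (by positivity)
  obtain ⟨R, hR1, -, hR⟩ := exists_correspondence_of_ghDist_lt hT
  obtain ⟨a', ha⟩ := hR1 a
  obtain ⟨b', hb⟩ := hR1 b
  have h1 : dist a b ≤ dist a' b' + ε := by linarith [(abs_le.1 (hR _ _ _ _ ha hb)).2]
  calc edist a b = ENNReal.ofReal (dist a b) := edist_dist a b
    _ ≤ ENNReal.ofReal (dist a' b' + ε) := ENNReal.ofReal_le_ofReal h1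
    _ = edist a' b' + ε := by
      rw [ENNReal.ofReal_add dist_nonneg ε.coe_nonneg, ← edist_dist, ENNReal.ofReal_coe_nnreal]
    _ ≤ Ω.D + ε := by
      gcongr
      exact (Metric.edist_le_ediam_of_mem (Set.mem_univ a') (Set.mem_univ b')).trans
        T.ediam_observed

/-- A sequence that is Cauchy for the gap has arbitrarily late terms close to a common limit. -/
theorem exists_limit_of_cauchy
    (hS : ∀ ε > 0, ∃ N, ∀ m ≥ N, ∀ n ≥ N, quantumIntertwiningGap (S m).ω (S n).ω < ε) :
    ∃ T : QuasiWassersteinSpace Ω, ∀ ε > 0, ∀ N, ∃ n ≥ N,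
      quantumIntertwiningGap T.ω (S n).ω < ε := by
  obtain ⟨p, -, k, hk, hp⟩ := ((totallyBounded_range_observed
    hS).closure.isCompact_of_isClosed isClosed_closure).tendsto_subseq
      fun n => subset_closure (Set.mem_range_self n)
  -- Representatives of Gromov-Hausdorff classes live in the lowest universe, whereas `Ω` concerns
  -- spaces in `Type u`.
  let X : Type u := ULift.{u} p.Rep
  let _ : MeasurableSpace X := borel X
  have : BorelSpace X := ⟨rfl⟩
  have hX : GromovHausdorff.toGHSpace X = p := by
    refine (GromovHausdorff.toGHSpace_eq_toGHSpace_iff_isometryEquiv.2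
      ⟨⟨Equiv.ulift, fun _ _ => rfl⟩⟩).trans (GromovHausdorff.GHSpace.toGHSpace_rep p)
  have hlim : ∀ η > 0, ∀ N, ∃ n ≥ N, GromovHausdorff.ghDist X (S n).Observed < η := by
    intro η hη N
    obtain ⟨M, hM⟩ := Metric.tendsto_atTop.1 hp η hη
    refine ⟨k (max M N), (le_max_right M N).trans hk.le_apply, ?_⟩
    rw [GromovHausdorff.ghDist, hX, dist_comm]
    exact hM _ (le_max_left M N)
  have hD : Metric.ediam (Set.univ : Set X) ≤ Ω.D := ediam_le_of_tendsto_ghDist fun η hη =>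
    by
    obtain ⟨n, -, hn⟩ := hlim η hη 0
    exact ⟨S n, hn⟩
  refine ⟨continuousMapSpace Ω X hD, fun ε hε N => ?_⟩
  obtain ⟨η, hη, h⟩ := (continuousMapSpace Ω X hD).exists_pos_forall_gap_lt hε hD
    (observes_continuousMap Ω)
  exact (hlim η hη N).imp fun n hn => ⟨hn.1, h _ hn.2⟩

end Precompact

/-! ### The quasimetric on tracial isomorphism classes -/

section Class

variable {Ω : QuasiWassersteinMetric.{u}}

/-- The quantum intertwining gap between tracial isomorphism classes. -/
noncomputable def classGap (a b : TracialClass Ω) : ℝ :=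
  quantumIntertwiningGap a.out.ω b.out.ω

theorem classGap_mk (S T : QuasiWassersteinSpace Ω) :
    classGap (tracialClass S) (tracialClass T) = quantumIntertwiningGap S.ω T.ω :=
  TraciallyIsomorphic.quantumIntertwiningGap_eq (QuasiWassersteinSpace.inducesTopology _)
    (QuasiWassersteinSpace.inducesTopology _) S.inducesTopology T.inducesTopology
    (Quotient.mk_out (s := tracialSetoid Ω) S) (Quotient.mk_out (s := tracialSetoid Ω) T)

theorem isQuasimetric_classGap : IsQuasimetric 2 (classGap (Ω := Ω)) where
  nonneg _ _ := quantumIntertwiningGap_nonneg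
  eq_zero_iff a b := by
    refine ⟨fun h => ?_, ?_⟩
    · rw [← a.out_eq, ← b.out_eq]
      exact Quotient.sound (a.out.traciallyIsomorphic_of_gap_eq_zero b.out h)
    · rintro rfl
      exact a.out.gap_self
  symm a b := congrArg sInf gapSet_comm
  triangle a b c := a.out.gap_triangle b.out c.out

theorem isSeparableQuasimetric_classGap : IsSeparableQuasimetric (classGap (Ω := Ω)) := by
  let p : TracialClass Ω → GromovHausdorff.GHSpace := fun a =>
    GromovHausdorff.toGHSpace a.out.Observed
  -- Density is taken within the set of observed spaces, so that every point of `t` comes from a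
  -- class.
  obtain ⟨t, htc, htd⟩ := TopologicalSpace.exists_countable_dense (Set.range p)
  have : Countable t := htc
  choose q hq using fun z : t => z.1.2
  refine ⟨Set.range q, Set.countable_range q, fun a ε hε => ?_⟩
  obtain ⟨η, hη, h⟩ := a.out.exists_pos_forall_gap_lt hε a.out.ediam_observed
    a.out.observes_observed
  obtain ⟨z, hz, hlt⟩ := htd.exists_dist_lt (⟨p a, a, rfl⟩ : Set.range p) hη
  refine ⟨q ⟨z, hz⟩, ⟨_, rfl⟩, h _ ?_⟩
  have e : p (q ⟨z, hz⟩) = z := hq ⟨z, hz⟩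
  change dist (p a) (p (q ⟨z, hz⟩)) < η
  rw [e]
  exact hlt

theorem isCompleteQuasimetric_classGap : IsCompleteQuasimetric (classGap (Ω := Ω)) := by
  intro x hx
  obtain ⟨T, hT⟩ := exists_limit_of_cauchy (S := fun n => (x n).out) hx
  refine ⟨tracialClass T, Metric.tendsto_atTop.2 fun ε hε => ?_⟩
  -- With the factor 2 in the triangle inequality, two errors of `ε / 4` add up to `ε`.
  obtain ⟨N, hN⟩ := hx (ε / 4) (by positivity)
  obtain ⟨m, hm, hTm⟩ := hT (ε / 4) (by positivity) N
  refine ⟨N, fun n hn => ?_⟩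
  have e1 := isQuasimetric_classGap.triangle (x n) (x m) (tracialClass T)
  have e2 : classGap (x m) (tracialClass T) < ε / 4 := by
    rw [isQuasimetric_classGap.symm, ← (x m).out_eq]
    exact (classGap_mk T (x m).out).trans_lt hTm
  rw [Real.dist_0_eq_abs, abs_of_nonneg (isQuasimetric_classGap.nonneg _ _)]
  linarith [hN n hn m hm]

end Class

theorem mainTheorem6 (Ω : QuasiWassersteinMetric.{u}) :
    (∀ S T : QuasiWassersteinSpace Ω, (gapSet S.ω T.ω).Nonempty) ∧
    ∃ γ : TracialClass Ω → TracialClass Ω → ℝ,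
      (∀ S T : QuasiWassersteinSpace Ω,
        γ (tracialClass S) (tracialClass T) = quantumIntertwiningGap S.ω T.ω) ∧
      IsQuasimetric 2 γ ∧ IsSeparableQuasimetric γ ∧ IsCompleteQuasimetric γ :=
  ⟨fun S T => S.gapSet_nonempty T, classGap, classGap_mk, isQuasimetric_classGap,
    isSeparableQuasimetric_classGap, isCompleteQuasimetric_classGap⟩
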